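/- Let $d\ge 1$ be an integer. Consider a deck of $2^d$ distinguishable cards, one at each vertex (position) of the hypercube $\{0,1\}^d$. For $1\le j\le d$ let $K_j$ be the following transition: for each edge of the hypercube in direction $j$ (joining two vertices that differ only in coordinate $j$) flip an independent fair coin, and interchange the two cards at its endpoints if the coin shows heads. The zigzag shuffle is the (time-inhomogeneous) Markov chain $X_0,X_1,X_2,\dots$, started from an arbitrary fixed arrangement $X_0$ of the cards, whose successive transitions are $K_1,\dots,K_d,K_d,\dots,K_1$, repeated periodically with period $2d$. For a card $z$ let $X_n(z)$ be its position at time $n$, and for a set $\Lambda$ of cards let $X_n(\Lambda)=\{X_n(z):z\in\Lambda\}$. There is a universal natural number $b$ such that, for every $d\ge 1$, with $m=b\,d^5$, $$\left|\binom{2^d}{|\Lambda|}\,\mathbf P\bigl(X_m(\Lambda)=\Lambda'\bigr)-1\right|\le \tfrac14$$ for every initial arrangement $X_0$, every set $\Lambda$ of cards and every set $\Lambda'\subseteq\{0,1\}^d$ of positions with $|\Lambda'|=|\Lambda|$. -/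

import Mathlib

/-- Positions of the cards: the vertices of the `d`-dimensional unit hypercube. -/
abbrev Cube (d : ℕ) : Type := Fin d → Bool

/-- The other endpoint of the edge in direction `j` at the vertex `x`. -/
def flipCoord {d : ℕ} (j : Fin d) (x : Cube d) : Cube d := Function.update x j (!x j)

/-- The edges of the hypercube in direction `j`; an edge is represented by its unique endpoint
whose `j`-th coordinate is `false`. -/
abbrev DirEdge {d : ℕ} (j : Fin d) : Type := {x : Cube d // x j = false}

/-- The edge in direction `j` that is incident to the vertex `x`. -/
def edgeAt {d : ℕ} (j : Fin d) (x : Cube d) : DirEdge j :=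
  ⟨Function.update x j false, by simp⟩

theorem flipCoord_flipCoord {d : ℕ} (j : Fin d) (x : Cube d) :
    flipCoord j (flipCoord j x) = x := by
  simp [flipCoord]

theorem edgeAt_flipCoord {d : ℕ} (j : Fin d) (x : Cube d) :
    edgeAt j (flipCoord j x) = edgeAt j x := by
  simp [edgeAt, flipCoord]

/-- The permutation of positions that interchanges the two endpoints of every edge `e` in
direction `j` whose coin `c e` shows heads (`true`) and fixes all other positions. -/
def switchEdges {d : ℕ} (j : Fin d) (c : DirEdge j → Bool) : Equiv.Perm (Cube d) :=
  Function.Involutive.toPerm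
    (fun x => if c (edgeAt j x) = true then flipCoord j x else x)
    (by
      intro x
      by_cases h : c (edgeAt j x) = true
      · simp [h, edgeAt_flipCoord, flipCoord_flipCoord]
      · simp [h])

/-- A state of the deck of `2 ^ d` cards: the bijection that sends each card to its position. -/
abbrev Deck (d : ℕ) : Type := Fin (2 ^ d) ≃ Cube d

/-- The transition kernel `K_j`: an independent fair coin is flipped for every edge in
direction `j` (so the vector of coins is uniform), and the cards at the endpoints of the edges
whose coin shows heads are interchanged. -/
noncomputable def ringKernel {d : ℕ} (j : Fin d) (X : Deck d) : PMF (Deck d) :=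
  (PMF.uniformOfFintype (DirEdge j → Bool)).map fun c => X.trans (switchEdges j c)

/-- The direction of the edges that ring in the step from time `n` to time `n + 1` of the zigzag
shuffle: the directions run periodically through
`0, 1, …, d - 1, d - 1, …, 1, 0` (period `2 * d`). -/
def zigzagDir (d : ℕ) [NeZero d] (n : ℕ) : Fin d :=
  if h : n % (2 * d) < d then ⟨n % (2 * d), h⟩
  else ⟨2 * d - 1 - n % (2 * d), by
    have hd : 0 < d := Nat.pos_of_ne_zero (NeZero.ne d)
    omega⟩

/-- The law of the state `X_n` at time `n` of the zigzag shuffle started from `X₀`. -/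
noncomputable def zigzagLaw (d : ℕ) [NeZero d] (X₀ : Deck d) : ℕ → PMF (Deck d)
  | 0 => PMF.pure X₀
  | n + 1 => (zigzagLaw d X₀ n).bind (ringKernel (zigzagDir d n))

/-- The set of positions `X(Λ)` occupied by the cards in the set `Λ`. -/
def positions {d : ℕ} (Λ : Finset (Fin (2 ^ d))) (X : Deck d) : Finset (Cube d) :=
  Λ.map X.toEmbedding

/-- `P(X_m(Λ) = Λ')` for the zigzag shuffle started from `X₀`. -/
noncomputable def moveProb (d : ℕ) [NeZero d] (X₀ : Deck d) (m : ℕ)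
    (Λ : Finset (Fin (2 ^ d))) (Λ' : Finset (Cube d)) : ℝ :=
  (((zigzagLaw d X₀ m).map (positions Λ)) Λ').toReal

/-! ### Pointwise inequalities -/

/-- The entropy function `x log x`. -/
noncomputable def xlogx (x : ℝ) : ℝ := x * Real.log x

theorem sq_sqrt_sub_le_log {a b : ℝ} (ha : 0 < a) (hb : 0 < b) :
    (√a - √b) ^ 2 ≤ a * Real.log (a / b) - a + b := by
  have hx := Real.sqrt_pos.2 ha
  have hy := Real.sqrt_pos.2 hb
  have hxa := Real.sq_sqrt ha.le
  have hyb := Real.sq_sqrt hb.le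
  set x := √a
  set y := √b
  have h1 : Real.log (a / b) = - (2 * Real.log (y / x)) := by
    rw [← hxa, ← hyb, ← div_pow, Real.log_pow, ← mul_neg, ← Real.log_inv, inv_div]
    simp
  have h2 : Real.log (y / x) ≤ y / x - 1 := Real.log_le_sub_one_of_pos (by positivity)
  have h3 : a * (y / x) = x * y := by rw [← hxa]; field_simp
  have h4 : a * Real.log (y / x) ≤ a * (y / x - 1) := mul_le_mul_of_nonneg_left h2 ha.le
  rw [h1]
  nlinarith

theorem log_sub_add_nonneg {a b : ℝ} (ha : 0 < a) (hb : 0 < b) :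
    a - b ≤ a * Real.log (a / b) := by
  have := sq_sqrt_sub_le_log ha hb
  have := sq_nonneg (√a - √b)
  linarith

theorem log_le_sq_sqrt_sub {a b : ℝ} (ha : 0 < a) (hb : 0 < b) {D : ℕ} (hD : 1 ≤ D)
    (hab : a ≤ 2 ^ D * b) :
    a * Real.log (a / b) - a + b ≤ 9 * D * (√a - √b) ^ 2 := by
  have hx := Real.sqrt_pos.2 ha
  have hy := Real.sqrt_pos.2 hb
  have hxa := Real.sq_sqrt ha.le
  have hyb := Real.sq_sqrt hb.le
  have hD' : (1 : ℝ) ≤ D := by exact_mod_cast hD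
  by_cases hxy : √a ≤ 4 * √b
  · have h1 : Real.log (a / b) = 2 * Real.log (√a / √b) := by
      rw [← Real.sqrt_div ha.le, Real.log_sqrt (by positivity)]; ring
    set x := √a
    set y := √b
    have h2 : Real.log (x / y) ≤ x / y - 1 := Real.log_le_sub_one_of_pos (by positivity)
    have h4 : a * Real.log (x / y) ≤ a * (x / y - 1) := mul_le_mul_of_nonneg_left h2 ha.le
    have h5 : 2 * (a * (x / y - 1)) - a + b ≤ 9 * (x - y) ^ 2 := by
      have : 2 * (a * (x / y - 1)) - a + b = (x - y) ^ 2 * (2 * (x / y) + 1) := by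
        rw [← hxa, ← hyb]; field_simp; ring
      rw [this]
      have h6 : x / y ≤ 4 := by rwa [div_le_iff₀ hy]
      nlinarith [sq_nonneg (x - y)]
    have h7 : 9 * (x - y) ^ 2 ≤ 9 * D * (x - y) ^ 2 := by
      nlinarith [sq_nonneg (x - y)]
    rw [h1]; linarith
  · push Not at hxy
    have h1 : Real.log (a / b) ≤ D := by
      have h2 : a / b ≤ 2 ^ D := by rwa [div_le_iff₀ hb]
      have h3 := Real.log_le_log (by positivity) h2
      rw [Real.log_pow] at h3
      have : Real.log 2 ≤ 1 := by linarith [Real.log_two_lt_d9]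
      nlinarith
    have h2 : a * Real.log (a / b) ≤ a * D := mul_le_mul_of_nonneg_left h1 ha.le
    set x := √a
    set y := √b
    have h3 : a ≤ 9 * (x - y) ^ 2 := by rw [← hxa]; nlinarith
    have h4 : b ≤ a := by rw [← hxa, ← hyb]; nlinarith
    nlinarith [mul_le_mul_of_nonneg_right h3 (by linarith : (0 : ℝ) ≤ D)]

theorem sq_sqrt_sub_le_xlogx {u v : ℝ} (hu : 0 < u) (hv : 0 < v) :
    (√u - √v) ^ 2 ≤ 2 * (xlogx u + xlogx v - 2 * xlogx ((u + v) / 2)) := by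
  have hm : 0 < (u + v) / 2 := by positivity
  have h1 := sq_sqrt_sub_le_log hu hm
  have h2 := sq_sqrt_sub_le_log hv hm
  rw [Real.log_div hu.ne' hm.ne'] at h1
  rw [Real.log_div hv.ne' hm.ne'] at h2
  unfold xlogx
  set m := √((u + v) / 2)
  nlinarith [sq_nonneg (√u - m + (√v - m))]

theorem sq_sqrt_sum_sub_le {ι : Type*} (s : Finset ι) {p a b : ι → ℝ} (hp : ∀ i, 0 ≤ p i)
    (ha : ∀ i, 0 ≤ a i) (hb : ∀ i, 0 ≤ b i) :
    (√(∑ i ∈ s, p i * a i) - √(∑ i ∈ s, p i * b i)) ^ 2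
      ≤ ∑ i ∈ s, p i * (√(a i) - √(b i)) ^ 2 := by
  have h1 : 0 ≤ ∑ i ∈ s, p i * a i := Finset.sum_nonneg fun i _ => mul_nonneg (hp i) (ha i)
  have h2 : 0 ≤ ∑ i ∈ s, p i * b i := Finset.sum_nonneg fun i _ => mul_nonneg (hp i) (hb i)
  have h3 := Real.sum_sqrt_mul_sqrt_le s (f := fun i => p i * a i) (g := fun i => p i * b i)
    (fun i => mul_nonneg (hp i) (ha i)) (fun i => mul_nonneg (hp i) (hb i))
  have h4 : ∑ i ∈ s, p i * (√(a i) - √(b i)) ^ 2 = ∑ i ∈ s, p i * a i + ∑ i ∈ s, p i * b i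
      - 2 * ∑ i ∈ s, √(p i * a i) * √(p i * b i) := by
    rw [Finset.mul_sum, ← Finset.sum_add_distrib, ← Finset.sum_sub_distrib]
    refine Finset.sum_congr rfl fun i _ => ?_
    rw [Real.sqrt_mul (hp i), Real.sqrt_mul (hp i)]
    linear_combination (p i) * (Real.sq_sqrt (ha i)) + (p i) * Real.sq_sqrt (hb i)
      + 2 * √(a i) * √(b i) * Real.sq_sqrt (hp i)
  rw [h4, sub_sq, Real.sq_sqrt h1, Real.sq_sqrt h2]
  nlinarith

theorem xlogx_sum_le {ι : Type*} (s : Finset ι) {p a : ι → ℝ} (hp : ∀ i, 0 ≤ p i)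
    (hp1 : ∑ i ∈ s, p i = 1) (ha : ∀ i, 0 ≤ a i) :
    xlogx (∑ i ∈ s, p i * a i) ≤ ∑ i ∈ s, p i * xlogx (a i) :=
  Real.convexOn_mul_log.map_sum_le (fun i _ => hp i) hp1 (fun i _ => ha i)

/-! ### Squared Hellinger distance -/

section Hellinger

variable {Ω : Type*} [Fintype Ω]

/-- The squared Hellinger distance of two nonnegative functions (counting measure). -/
noncomputable def hel (a b : Ω → ℝ) : ℝ := ∑ x, (√(a x) - √(b x)) ^ 2

theorem hel_nonneg (a b : Ω → ℝ) : 0 ≤ hel a b := Finset.sum_nonneg fun _ _ => sq_nonneg _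

theorem hel_self (a : Ω → ℝ) : hel a a = 0 := by simp [hel]

theorem hel_comm (a b : Ω → ℝ) : hel a b = hel b a :=
  Finset.sum_congr rfl fun _ _ => by ring

theorem hel_triangle (a b c : Ω → ℝ) : hel a c ≤ 2 * hel a b + 2 * hel b c := by
  unfold hel
  rw [Finset.mul_sum, Finset.mul_sum, ← Finset.sum_add_distrib]
  refine Finset.sum_le_sum fun x _ => ?_
  nlinarith [sq_nonneg (√(a x) - √(b x) - (√(b x) - √(c x)))]

theorem hel_triangle₃ (a b c e : Ω → ℝ) :
    hel a e ≤ 3 * hel a b + 3 * hel b c + 3 * hel c e := by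
  unfold hel
  rw [Finset.mul_sum, Finset.mul_sum, Finset.mul_sum, ← Finset.sum_add_distrib,
    ← Finset.sum_add_distrib]
  refine Finset.sum_le_sum fun x _ => ?_
  nlinarith [sq_nonneg (√(a x) - √(b x) - (√(b x) - √(c x))),
    sq_nonneg (√(a x) - √(b x) - (√(c x) - √(e x))),
    sq_nonneg (√(b x) - √(c x) - (√(c x) - √(e x)))]

theorem hel_sum_le {ι : Type*} (s : Finset ι) {p : ι → ℝ} {a b : ι → Ω → ℝ}
    (hp : ∀ i, 0 ≤ p i) (ha : ∀ i x, 0 ≤ a i x) (hb : ∀ i x, 0 ≤ b i x) :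
    hel (fun x => ∑ i ∈ s, p i * a i x) (fun x => ∑ i ∈ s, p i * b i x)
      ≤ ∑ i ∈ s, p i * hel (a i) (b i) := by
  unfold hel
  simp_rw [Finset.mul_sum]
  rw [Finset.sum_comm]
  exact Finset.sum_le_sum fun x _ =>
    sq_sqrt_sum_sub_le s hp (fun i => ha i x) (fun i => hb i x)

theorem hel_comp_equiv (e : Ω ≃ Ω) (a b : Ω → ℝ) :
    hel (fun x => a (e x)) (fun x => b (e x)) = hel a b :=
  e.sum_comp fun x => (√(a x) - √(b x)) ^ 2

end Hellinger

/-! ### Averages over subgroups of permutations -/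

section SubgroupAverage

variable {G : Type*} [Group G] [Fintype G]

open scoped Classical in
/-- The average of `f` over the orbits of the subgroup `H` acting by left multiplication. -/
noncomputable def avgSub (H : Subgroup G) (f : G → ℝ) (X : G) : ℝ :=
  ∑ g : H, (Fintype.card H : ℝ)⁻¹ * f (g * X)

open scoped Classical in
theorem avgSub_weight_sum (H : Subgroup G) : ∑ _g : H, (Fintype.card H : ℝ)⁻¹ = 1 := by
  rw [Finset.sum_const, Finset.card_univ, nsmul_eq_mul, mul_inv_cancel₀]
  exact_mod_cast Fintype.card_ne_zero

theorem avgSub_pos (H : Subgroup G) {f : G → ℝ} (hf : ∀ X, 0 < f X) (X : G) :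
    0 < avgSub H f X := by
  classical
  exact Finset.sum_pos (fun _ _ => mul_pos (by positivity) (hf _)) Finset.univ_nonempty

theorem avgSub_nonneg (H : Subgroup G) {f : G → ℝ} (hf : ∀ X, 0 ≤ f X) (X : G) :
    0 ≤ avgSub H f X :=
  Finset.sum_nonneg (fun _ _ => mul_nonneg (by positivity) (hf _))

theorem avgSub_mono (H : Subgroup G) {f f' : G → ℝ} (hf : ∀ X, f X ≤ f' X) (X : G) :
    avgSub H f X ≤ avgSub H f' X :=
  Finset.sum_le_sum (fun _ _ => mul_le_mul_of_nonneg_left (hf _) (by positivity))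

theorem avgSub_const (H : Subgroup G) (c : ℝ) (X : G) : avgSub H (fun _ => c) X = c := by
  classical
  unfold avgSub
  rw [← Finset.sum_mul, avgSub_weight_sum, one_mul]

theorem avgSub_sum {ι : Type*} (H : Subgroup G) (s : Finset ι) (p : ι → ℝ) (F : ι → G → ℝ)
    (X : G) :
    avgSub H (fun Y => ∑ i ∈ s, p i * F i Y) X = ∑ i ∈ s, p i * avgSub H (F i) X := by
  unfold avgSub
  simp_rw [Finset.mul_sum]
  rw [Finset.sum_comm]
  exact Finset.sum_congr rfl fun i _ => Finset.sum_congr rfl fun _ _ => by ring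

theorem avgSub_add (H : Subgroup G) (f f' : G → ℝ) (X : G) :
    avgSub H (fun Y => f Y + f' Y) X = avgSub H f X + avgSub H f' X := by
  unfold avgSub
  rw [← Finset.sum_add_distrib]
  exact Finset.sum_congr rfl fun _ _ => by ring

theorem avgSub_const_mul (H : Subgroup G) (c : ℝ) (f : G → ℝ) (X : G) :
    avgSub H (fun Y => c * f Y) X = c * avgSub H f X := by
  unfold avgSub
  rw [Finset.mul_sum]
  exact Finset.sum_congr rfl fun _ _ => by ring

theorem avgSub_mul_left (H : Subgroup G) {k : G} (hk : k ∈ H) (f : G → ℝ) (X : G) :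
    avgSub H (fun Y => f (k * Y)) X = avgSub H f X := by
  classical
  unfold avgSub
  refine Fintype.sum_equiv (Equiv.mulLeft (⟨k, hk⟩ : H)) _ _ fun g => ?_
  simp [mul_assoc]

theorem avgSub_apply_mul (H : Subgroup G) {k : G} (hk : k ∈ H) (f : G → ℝ) (X : G) :
    avgSub H f (k * X) = avgSub H f X := by
  classical
  unfold avgSub
  refine Fintype.sum_equiv (Equiv.mulRight (⟨k, hk⟩ : H)) _ _ fun g => ?_
  simp [mul_assoc]

/-- A function that is constant on `H`-orbits can be pulled out of the average. -/
theorem avgSub_mul_of_invariant (H : Subgroup G) {f u : G → ℝ}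
    (hu : ∀ k ∈ H, ∀ X, u (k * X) = u X) (X : G) :
    avgSub H (fun Y => f Y * u Y) X = avgSub H f X * u X := by
  unfold avgSub
  rw [Finset.sum_mul]
  refine Finset.sum_congr rfl fun g _ => ?_
  rw [← hu g g.2 X]; ring

theorem avgSub_of_invariant (H : Subgroup G) {u : G → ℝ}
    (hu : ∀ k ∈ H, ∀ X, u (k * X) = u X) (X : G) : avgSub H u X = u X := by
  have := avgSub_mul_of_invariant H (f := fun _ => 1) hu X
  simpa [avgSub_const] using this

theorem sum_avgSub_mul (H : Subgroup G) (f f' : G → ℝ) :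
    ∑ X, avgSub H f X * f' X = ∑ X, f X * avgSub H f' X := by
  classical
  unfold avgSub
  simp_rw [Finset.sum_mul, Finset.mul_sum]
  rw [Finset.sum_comm]
  conv_rhs => rw [Finset.sum_comm]
  refine Fintype.sum_equiv (Equiv.inv H) _ _ fun g => ?_
  refine Fintype.sum_equiv (Equiv.mulLeft (g : G)) _ _ fun X => ?_
  simp; ring

theorem sum_avgSub (H : Subgroup G) (f : G → ℝ) : ∑ X, avgSub H f X = ∑ X, f X := by
  have := sum_avgSub_mul H f (fun _ => 1)
  simpa [avgSub_const] using this

theorem avgSub_avgSub_of_le {H K : Subgroup G} (h : H ≤ K) (f : G → ℝ) (X : G) :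
    avgSub K (avgSub H f) X = avgSub K f X := by
  classical
  have h1 : avgSub K (avgSub H f) X
      = avgSub K (fun Y => ∑ g : H, (Fintype.card H : ℝ)⁻¹ * f (g * Y)) X := rfl
  rw [h1, avgSub_sum]
  have h2 : ∀ g : H, avgSub K (fun Y => f (g * Y)) X = avgSub K f X := fun g =>
    avgSub_mul_left K (h g.2) f X
  simp_rw [h2]
  rw [← Finset.sum_mul, avgSub_weight_sum, one_mul]

theorem hel_avgSub_le (H : Subgroup G) {a b : G → ℝ} (ha : ∀ X, 0 ≤ a X) (hb : ∀ X, 0 ≤ b X) :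
    hel (avgSub H a) (avgSub H b) ≤ hel a b := by
  classical
  refine (hel_sum_le (Finset.univ : Finset H) (p := fun _ => (Fintype.card H : ℝ)⁻¹)
    (a := fun g X => a (g * X)) (b := fun g X => b (g * X)) (fun _ => by positivity)
    (fun _ _ => ha _) (fun _ _ => hb _)).trans ?_
  have : ∀ g : H, hel (fun X => a (g * X)) (fun X => b (g * X)) = hel a b := fun g =>
    hel_comp_equiv (Equiv.mulLeft (g : G)) a b
  simp_rw [this]
  rw [← Finset.sum_mul, avgSub_weight_sum, one_mul]

theorem xlogx_avgSub_le (H : Subgroup G) {f : G → ℝ} (hf : ∀ X, 0 ≤ f X) (X : G) :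
    xlogx (avgSub H f X) ≤ avgSub H (fun Y => xlogx (f Y)) X := by
  classical
  exact xlogx_sum_le Finset.univ (fun _ => by positivity) (avgSub_weight_sum H) fun _ => hf _

theorem sum_xlogx_avgSub_le (H : Subgroup G) {f : G → ℝ} (hf : ∀ X, 0 ≤ f X) :
    ∑ X, xlogx (avgSub H f X) ≤ ∑ X, xlogx (f X) := by
  rw [← sum_avgSub H fun X => xlogx (f X)]
  exact Finset.sum_le_sum fun X _ => xlogx_avgSub_le H hf X

end SubgroupAverage

/-! ### Averaging over the permutations of a growing set of sites -/

section Chain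

variable {V : Type*}

/-- The permutations that fix every point outside `U`. -/
def permsOn (U : Finset V) : Subgroup (Equiv.Perm V) where
  carrier := {g | ∀ x, x ∉ U → g x = x}
  one_mem' := fun _ _ => rfl
  mul_mem' := fun {a b} ha hb x hx => by
    simp only [Set.mem_ofPred_eq] at ha hb
    rw [Equiv.Perm.mul_apply, hb x hx, ha x hx]
  inv_mem' := fun {a} ha x hx => by
    rw [Equiv.Perm.inv_eq_iff_eq, ha x hx]

theorem permsOn_mono {U W : Finset V} (h : U ⊆ W) : permsOn U ≤ permsOn W :=
  fun _ hg x hx => hg x fun hU => hx (h hU)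

variable [DecidableEq V]

theorem swap_mem_permsOn {U : Finset V} {i j : V} (hi : i ∈ U) (hj : j ∈ U) :
    Equiv.swap i j ∈ permsOn U := fun _ hx =>
  Equiv.swap_apply_of_ne_of_ne (fun h => hx (h ▸ hi)) (fun h => hx (h ▸ hj))

theorem swap_mul_eq_mul_swap {U : Finset V} {i j : V} (hi : i ∉ U) (hj : j ∉ U)
    {g : Equiv.Perm V} (hg : g ∈ permsOn U) : g * Equiv.swap i j = Equiv.swap i j * g := by
  have h := Equiv.mul_swap_eq_swap_mul g i j
  rwa [hg i hi, hg j hj] at h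

/-- A permutation of `insert i U` is determined by the image of `i` and a permutation of `U`. -/
def permsOnInsertEquiv {U : Finset V} {i : V} (hi : i ∉ U) :
    permsOn (insert i U) ≃ {x // x ∈ insert i U} × permsOn U where
  toFun g := (⟨g.1 i, by
      by_contra h
      have h1 := g.2 _ h
      have h2 := g.1.injective h1
      exact h (by rw [h2]; exact Finset.mem_insert_self i U)⟩,
    ⟨Equiv.swap i (g.1 i) * g.1, fun x hx => by
      by_cases hxi : x = i
      · subst hxi; simp
      · have hx' : x ∉ insert i U := by simp [hxi, hx]
        have h1 : g.1 x = x := g.2 x hx'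
        rw [Equiv.Perm.mul_apply, h1]
        refine Equiv.swap_apply_of_ne_of_ne hxi fun h => hxi ?_
        rw [← h1] at h
        exact g.1.injective h⟩)
  invFun p := ⟨Equiv.swap i p.1.1 * p.2.1,
    (permsOn (insert i U)).mul_mem
      (swap_mem_permsOn (Finset.mem_insert_self i U) p.1.2)
      (permsOn_mono (Finset.subset_insert i U) p.2.2)⟩
  left_inv g := by
    ext1
    simp
  right_inv p := by
    have h : p.2.1 i = i := p.2.2 i hi
    refine Prod.ext (Subtype.ext ?_) (Subtype.ext ?_)
    · simp [h]
    · simp [h]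

/-- The sites in `L` together with the first `t` of the sites `e 0, e 1, …`. -/
def siteChain {n : ℕ} (L : Finset V) (e : Fin n → V) (t : ℕ) : Finset V :=
  L ∪ (Finset.univ.filter fun a : Fin n => (a : ℕ) < t).image e

variable {n : ℕ} {L : Finset V} {e : Fin n → V}

theorem siteChain_zero : siteChain L e 0 = L := by simp [siteChain]

theorem mem_siteChain {t : ℕ} {x : V} :
    x ∈ siteChain L e t ↔ x ∈ L ∨ ∃ a : Fin n, (a : ℕ) < t ∧ e a = x := by
  simp [siteChain]

theorem siteChain_mono {s t : ℕ} (h : s ≤ t) : siteChain L e s ⊆ siteChain L e t := by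
  intro x
  rw [mem_siteChain, mem_siteChain]
  rintro (hx | ⟨a, ha, rfl⟩)
  · exact Or.inl hx
  · exact Or.inr ⟨a, ha.trans_le h, rfl⟩

theorem siteChain_succ (t : Fin n) :
    siteChain L e (t + 1) = insert (e t) (siteChain L e t) := by
  ext x
  rw [Finset.mem_insert, mem_siteChain, mem_siteChain]
  constructor
  · rintro (hx | ⟨a, ha, rfl⟩)
    · exact Or.inr (Or.inl hx)
    · rcases Nat.lt_succ_iff_lt_or_eq.1 ha with h | h
      · exact Or.inr (Or.inr ⟨a, h, rfl⟩)
      · exact Or.inl (by rw [Fin.ext h])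
  · rintro (rfl | hx | ⟨a, ha, rfl⟩)
    · exact Or.inr ⟨t, Nat.lt_succ_self _, rfl⟩
    · exact Or.inl hx
    · exact Or.inr ⟨a, ha.trans (Nat.lt_succ_self _), rfl⟩

theorem notMem_siteChain (he : Function.Injective e) (hd : ∀ t, e t ∉ L) {s : ℕ} (t : Fin n)
    (hst : s ≤ t) : e t ∉ siteChain L e s := by
  rw [mem_siteChain]
  rintro (h | ⟨a, ha, h⟩)
  · exact hd t h
  · rw [he h] at ha
    omega

theorem sum_siteChain (he : Function.Injective e) (hd : ∀ t, e t ∉ L) (t : ℕ) (F : V → ℝ) :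
    ∑ l ∈ siteChain L e t, F l
      = ∑ l ∈ L, F l + ∑ a ∈ Finset.univ.filter fun a : Fin n => (a : ℕ) < t, F (e a) := by
  unfold siteChain
  rw [Finset.sum_union, Finset.sum_image fun a _ b _ h => he h]
  rw [Finset.disjoint_right]
  intro x hx
  obtain ⟨a, -, rfl⟩ := Finset.mem_image.1 hx
  exact hd a

theorem card_siteChain (he : Function.Injective e) (hd : ∀ t, e t ∉ L) (hL : L.card = n)
    (t : Fin n) : (siteChain L e t).card = n + t := by
  have key : ∀ k : ℕ, k ≤ n → (siteChain L e k).card = n + k := by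
    intro k
    induction k with
    | zero => intro _; rw [siteChain_zero, hL, add_zero]
    | succ k ih =>
      intro hk
      have := siteChain_succ (L := L) (e := e) ⟨k, hk⟩
      simp only at this
      rw [this, Finset.card_insert_of_notMem (notMem_siteChain he hd _ le_rfl), ih (by omega)]
      rfl
  exact key t t.2.le

variable [Fintype V]

theorem avgSub_permsOn_insert {U : Finset V} {i : V} (hi : i ∉ U) (h : Equiv.Perm V → ℝ)
    (X : Equiv.Perm V) :
    avgSub (permsOn (insert i U)) h X = ∑ l ∈ insert i U,
      ((U.card : ℝ) + 1)⁻¹ * avgSub (permsOn U) (fun Y => h (Equiv.swap i l * Y)) X := by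
  classical
  have hcard : Fintype.card (permsOn (insert i U))
      = (U.card + 1) * Fintype.card (permsOn U) := by
    rw [Fintype.card_congr (permsOnInsertEquiv hi), Fintype.card_prod, Fintype.card_coe,
      Finset.card_insert_of_notMem hi]
  unfold avgSub
  rw [Fintype.sum_equiv (permsOnInsertEquiv hi) _
    (fun p => (Fintype.card (permsOn (insert i U)) : ℝ)⁻¹ *
      h (Equiv.swap i p.1.1 * (p.2.1 * X)))]
  · rw [Fintype.sum_prod_type, ← Finset.sum_coe_sort (insert i U)]
    refine Finset.sum_congr rfl fun l _ => ?_
    rw [Finset.mul_sum]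
    refine Finset.sum_congr rfl fun g _ => ?_
    rw [hcard]; push_cast
    rw [mul_inv, mul_assoc]
  · intro g
    simp [permsOnInsertEquiv, ← mul_assoc]

theorem avgSub_apply_of_commute (H : Subgroup (Equiv.Perm V)) {k : Equiv.Perm V}
    (hk : ∀ g ∈ H, g * k = k * g) (h : Equiv.Perm V → ℝ) (X : Equiv.Perm V) :
    avgSub H h (k * X) = avgSub H (fun Y => h (k * Y)) X := by
  classical
  unfold avgSub
  refine Finset.sum_congr rfl fun g _ => ?_
  rw [← mul_assoc, hk g g.2, mul_assoc]

/-- The law of the site `e t` after it has been interchanged with a uniform site of `L`, when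
only the sites outside `siteChain L e t` are observed. -/
noncomputable def swapMean (L : Finset V) (e : Fin n → V) (h : Equiv.Perm V → ℝ) (t : Fin n)
    (X : Equiv.Perm V) : ℝ :=
  ∑ j ∈ L, (n : ℝ)⁻¹ *
    avgSub (permsOn (siteChain L e t)) (fun Y => h (Equiv.swap (e t) j * Y)) X

theorem swapMean_nonneg {h : Equiv.Perm V → ℝ} (hh : ∀ X, 0 ≤ h X) (t : Fin n)
    (X : Equiv.Perm V) : 0 ≤ swapMean L e h t X :=
  Finset.sum_nonneg fun _ _ => mul_nonneg (by positivity) (avgSub_nonneg _ (fun _ => hh _) _)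

theorem hel_swap_swapMean_le (he : Function.Injective e) (hd : ∀ t, e t ∉ L)
    {h : Equiv.Perm V → ℝ} (hh : ∀ X, 0 ≤ h X) {a t : Fin n} (hat : a < t) :
    hel (avgSub (permsOn (siteChain L e t)) fun Y => h (Equiv.swap (e t) (e a) * Y))
        (swapMean L e h t)
      ≤ hel (avgSub (permsOn (siteChain L e a)) h) (swapMean L e h a) := by
  set τ := Equiv.swap (e t) (e a)
  have hle : permsOn (siteChain L e (a : ℕ)) ≤ permsOn (siteChain L e (t : ℕ)) :=
    permsOn_mono (siteChain_mono hat.le)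
  have hcomm : ∀ g ∈ permsOn (siteChain L e (a : ℕ)), g * τ = τ * g := fun g hg =>
    swap_mul_eq_mul_swap (notMem_siteChain he hd t hat.le) (notMem_siteChain he hd a le_rfl) hg
  rw [← hel_comp_equiv (Equiv.mulLeft τ) (avgSub (permsOn (siteChain L e a)) h)]
  refine le_trans (le_of_eq ?_) (hel_avgSub_le (permsOn (siteChain L e t))
    (fun X => avgSub_nonneg _ hh _) (fun X => swapMean_nonneg hh _ _))
  congr 1
  · funext X
    simp only [Equiv.coe_mulLeft]
    simp_rw [avgSub_apply_of_commute _ hcomm]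
    exact (avgSub_avgSub_of_le hle _ X).symm
  · funext X
    simp only [Equiv.coe_mulLeft, swapMean]
    simp_rw [avgSub_apply_of_commute _ hcomm]
    rw [avgSub_sum]
    refine Finset.sum_congr rfl fun j hj => ?_
    congr 1
    rw [avgSub_avgSub_of_le hle]
    have hj' : j ∈ siteChain L e t := mem_siteChain.2 (Or.inl hj)
    have ha' : e a ∈ siteChain L e t := mem_siteChain.2 (Or.inr ⟨a, hat, rfl⟩)
    rw [← avgSub_mul_left _ (swap_mem_permsOn ha' hj')]
    congr 1
    funext Y
    rw [← mul_assoc, ← mul_assoc]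
    congr 2
    have h1 : e a ≠ e t := fun h => hat.ne (he h)
    have h2 : e t ≠ j := fun h => hd t (h ▸ hj)
    have h3 : e a ≠ j := fun h => hd a (h ▸ hj)
    ext x
    simp only [Equiv.Perm.mul_apply, τ, Equiv.swap_apply_def]
    split_ifs <;> simp_all

theorem hel_chain_step_le (he : Function.Injective e) (hd : ∀ t, e t ∉ L) (hL : L.card = n)
    {h : Equiv.Perm V → ℝ} (hh : ∀ X, 0 ≤ h X) (t : Fin n) :
    hel (avgSub (permsOn (siteChain L e t)) h) (avgSub (permsOn (siteChain L e (t + 1))) h)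
      ≤ 2 * hel (avgSub (permsOn (siteChain L e t)) h) (swapMean L e h t)
        + 2 * ((n : ℝ)⁻¹ *
          ∑ a : Fin n, hel (avgSub (permsOn (siteChain L e a)) h) (swapMean L e h a)) := by
  classical
  have hn : 0 < n := t.pos
  refine (hel_triangle _ (swapMean L e h t) _).trans ?_
  gcongr
  set v : V → Equiv.Perm V → ℝ := fun l =>
    avgSub (permsOn (siteChain L e t)) (fun Y => h (Equiv.swap (e t) l * Y)) with hv
  set q : ℝ := ((n : ℝ) + t + 1)⁻¹ with hq
  have hq0 : 0 ≤ q := by positivity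
  have hcard : ((siteChain L e t).card : ℝ) + 1 = n + t + 1 := by
    rw [card_siteChain he hd hL]; push_cast; ring
  have hP : avgSub (permsOn (siteChain L e (t + 1))) h
      = fun X => ∑ l ∈ siteChain L e (t + 1), q * v l X := by
    funext X
    rw [siteChain_succ, avgSub_permsOn_insert (notMem_siteChain he hd t le_rfl), hcard]
  have hcount : (∑ _a ∈ Finset.univ.filter fun a : Fin n => (a : ℕ) < (t : ℕ) + 1, (1 : ℝ)) = t + 1 := by
    have h1 : (Finset.univ.filter fun a : Fin n => (a : ℕ) < (t : ℕ) + 1) = Finset.Iic t := by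
      ext a; rw [Finset.mem_filter, Finset.mem_Iic, Fin.le_def]; simp only [Finset.mem_univ, true_and]; omega
    rw [h1]; simp
  have hm : swapMean L e h t = fun X => ∑ l ∈ siteChain L e (t + 1),
      q * (if l ∈ L then v l X else swapMean L e h t X) := by
    funext X
    rw [sum_siteChain he hd]
    have h1 : ∑ l ∈ L, q * (if l ∈ L then v l X else swapMean L e h t X)
        = q * n * swapMean L e h t X := by
      unfold swapMean
      rw [Finset.mul_sum]
      refine Finset.sum_congr rfl fun l hl => ?_
      rw [if_pos hl, hv]
      field_simp
    have h2 : ∑ a ∈ Finset.univ.filter fun a : Fin n => (a : ℕ) < (t : ℕ) + 1,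
        q * (if e a ∈ L then v (e a) X else swapMean L e h t X)
        = q * (t + 1) * swapMean L e h t X := by
      rw [← hcount, Finset.mul_sum, Finset.sum_mul]
      refine Finset.sum_congr rfl fun a _ => ?_
      rw [if_neg (hd a)]; ring
    rw [h1, h2, hq]
    field_simp
    ring
  have hv0 : ∀ l X, 0 ≤ v l X := fun l X => avgSub_nonneg _ (fun _ => hh _) _
  have hm0 := swapMean_nonneg (L := L) (e := e) hh t
  rw [hP]
  conv_lhs => rw [hm]
  refine (hel_sum_le (siteChain L e (t + 1)) (p := fun _ => q)
    (a := fun l X => if l ∈ L then v l X else swapMean L e h t X) (b := v)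
    (fun _ => hq0) (fun l X => by split_ifs; exacts [hv0 l X, hm0 X]) hv0).trans ?_
  rw [sum_siteChain he hd]
  have h1 : ∑ l ∈ L, q * hel (fun X => if l ∈ L then v l X else swapMean L e h t X) (v l) = 0 :=
    Finset.sum_eq_zero fun l hl => by simp [hl, hel_self]
  rw [h1, zero_add, Finset.mul_sum]
  refine (Finset.sum_le_sum fun a ha => ?_).trans
    (Finset.sum_le_sum_of_subset_of_nonneg (Finset.filter_subset _ _)
      fun a _ _ => mul_nonneg (by positivity) (hel_nonneg _ _))
  simp only [if_neg (hd a)]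
  have hqn : q ≤ (n : ℝ)⁻¹ := by
    rw [hq]
    apply inv_anti₀ (by exact_mod_cast hn)
    have : (0 : ℝ) ≤ t := by positivity
    linarith
  refine mul_le_mul hqn ?_ (hel_nonneg _ _) (by positivity)
  rw [hel_comm]
  have ha' : (a : ℕ) < (t : ℕ) + 1 := (Finset.mem_filter.1 ha).2
  rcases Nat.lt_succ_iff_lt_or_eq.1 ha' with hlt | heq
  · exact hel_swap_swapMean_le he hd hh hlt
  · have : a = t := Fin.ext heq
    subst this
    simp only [hv, Equiv.swap_self]
    exact le_rfl

theorem sum_hel_chain_le (he : Function.Injective e) (hd : ∀ t, e t ∉ L) (hL : L.card = n)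
    {h : Equiv.Perm V → ℝ} (hh : ∀ X, 0 ≤ h X) :
    ∑ t : Fin n, hel (avgSub (permsOn (siteChain L e t)) h)
        (avgSub (permsOn (siteChain L e (t + 1))) h)
      ≤ 4 * ∑ t : Fin n, hel (avgSub (permsOn (siteChain L e t)) h) (swapMean L e h t) := by
  refine (Finset.sum_le_sum fun t _ => hel_chain_step_le he hd hL hh t).trans ?_
  rw [Finset.sum_add_distrib, ← Finset.mul_sum, Finset.sum_const, Finset.card_univ,
    Fintype.card_fin, nsmul_eq_mul]
  rcases Nat.eq_zero_or_pos n with rfl | hn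
  · simp
  · apply le_of_eq
    field_simp
    ring

/-- Averaging over a matching loses at least the entropy lost along the chain. -/
theorem sum_hel_matching_le (he : Function.Injective e) (hd : ∀ t, e t ∉ L)
    {m : Fin n → V} (hm : ∀ t, m t ∈ L) (hmi : Function.Injective m)
    {K : Subgroup (Equiv.Perm V)} (hK : ∀ t, Equiv.swap (e t) (m t) ∈ K)
    {h : Equiv.Perm V → ℝ} (hh : ∀ X, 0 < h X) :
    ∑ t : Fin n, hel (avgSub (permsOn (siteChain L e t)) h)
        (avgSub (permsOn (siteChain L e t)) fun Y => h (Equiv.swap (e t) (m t) * Y))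
      ≤ 4 * (∑ X, xlogx (h X) - ∑ X, xlogx (avgSub K h X)) := by
  classical
  set P : Fin n → (Equiv.Perm V → ℝ) → Equiv.Perm V → ℝ :=
    fun t => avgSub (permsOn (siteChain L e t)) with hP
  set τ : Fin n → Equiv.Perm V := fun t => Equiv.swap (e t) (m t) with hτ
  have hτmem : ∀ s t : Fin n, t < s → τ t ∈ permsOn (siteChain L e s) := fun s t hts =>
    swap_mem_permsOn (mem_siteChain.2 (Or.inr ⟨t, hts, rfl⟩)) (mem_siteChain.2 (Or.inl (hm t)))
  have hcomm : ∀ s t : Fin n, t < s → τ t * τ s = τ s * τ t := by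
    intro s t hts
    have h1 := Equiv.mul_swap_eq_swap_mul (τ t) (e s) (m s)
    have h2 : τ t (e s) = e s := Equiv.swap_apply_of_ne_of_ne (fun h => hts.ne (he h.symm))
      (fun h => hd s (h ▸ hm t))
    have h3 : τ t (m s) = m s := Equiv.swap_apply_of_ne_of_ne (fun h => hd t (h ▸ hm s))
      (fun h => hts.ne (hmi h.symm))
    rwa [h2, h3] at h1
  have key : ∀ k : ℕ, k ≤ n → ∃ u : Equiv.Perm V → ℝ, (∀ X, 0 < u X) ∧
      (∀ X, avgSub K u X = avgSub K h X) ∧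
      (∀ s : Fin n, k ≤ s → P s u = P s h ∧
        P s (fun Y => u (τ s * Y)) = P s (fun Y => h (τ s * Y))) ∧
      ∑ t ∈ Finset.univ.filter fun a : Fin n => (a : ℕ) < k, hel (P t h) (P t fun Y => h (τ t * Y))
        ≤ 4 * (∑ X, xlogx (h X) - ∑ X, xlogx (u X)) := by
    intro k
    induction k with
    | zero => exact fun _ => ⟨h, hh, fun _ => rfl, fun _ _ => ⟨rfl, rfl⟩, by simp⟩
    | succ k ih =>
      intro hk
      obtain ⟨u, hu, huK, huP, hsum⟩ := ih (by omega)
      set t : Fin n := ⟨k, hk⟩ with ht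
      refine ⟨fun X => (1 / 2) * (u X + u (τ t * X)), fun X => ?_, fun X => ?_, fun s hs => ?_, ?_⟩
      · have := hu X; have := hu (τ t * X); positivity
      · rw [avgSub_const_mul, avgSub_add, avgSub_mul_left K (hK t), huK]; ring
      · have hts : t < s := by rw [Fin.lt_def]; exact hs
        obtain ⟨h1, h2⟩ := huP s (by omega)
        constructor
        · funext X
          simp only [hP]
          rw [avgSub_const_mul, avgSub_add, avgSub_mul_left _ (hτmem s t hts)]
          have := congrFun h1 X
          simp only [hP] at this
          rw [this]; ring
        · funext X
          simp only [hP]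
          rw [avgSub_const_mul, avgSub_add]
          have h3 : (fun Y => u (τ t * (τ s * Y))) = fun Y => u (τ s * (τ t * Y)) := by
            funext Y; rw [← mul_assoc, hcomm s t hts, mul_assoc]
          rw [h3, avgSub_mul_left _ (hτmem s t hts) (fun Y => u (τ s * Y))]
          have := congrFun h2 X
          simp only [hP] at this
          rw [this]; ring
      · have hfil : (Finset.univ.filter fun a : Fin n => (a : ℕ) < k + 1)
            = insert t (Finset.univ.filter fun a : Fin n => (a : ℕ) < k) := by
          ext a
          simp only [Finset.mem_filter, Finset.mem_univ, true_and, Finset.mem_insert, Fin.ext_iff,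
            ht]
          omega
        rw [hfil, Finset.sum_insert (by simp [ht])]
        have h1 : hel (P t h) (P t fun Y => h (τ t * Y)) ≤ hel u (fun Y => u (τ t * Y)) := by
          obtain ⟨h1, h2⟩ := huP t le_rfl
          rw [← h1, ← h2]
          exact hel_avgSub_le _ (fun X => (hu X).le) (fun X => (hu _).le)
        have h2 : hel u (fun Y => u (τ t * Y)) ≤
            4 * (∑ X, xlogx (u X) - ∑ X, xlogx ((1 / 2) * (u X + u (τ t * X)))) := by
          have h3 : ∑ X, xlogx (u (τ t * X)) = ∑ X, xlogx (u X) :=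
            Equiv.sum_comp (Equiv.mulLeft (τ t)) fun X => xlogx (u X)
          have h4 : hel u (fun Y => u (τ t * Y)) ≤ ∑ X, 2 * (xlogx (u X) + xlogx (u (τ t * X))
              - 2 * xlogx ((1 / 2) * (u X + u (τ t * X)))) := by
            refine Finset.sum_le_sum fun X _ => ?_
            have := sq_sqrt_sub_le_xlogx (hu X) (hu (τ t * X))
            rwa [show (u X + u (τ t * X)) / 2 = (1 / 2) * (u X + u (τ t * X)) by ring] at this
          rw [← Finset.mul_sum, Finset.sum_sub_distrib, Finset.sum_add_distrib, h3,
            ← Finset.mul_sum] at h4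
          linarith
        linarith
  obtain ⟨u, hu, huK, -, hsum⟩ := key n le_rfl
  have h1 : (Finset.univ.filter fun a : Fin n => (a : ℕ) < n) = Finset.univ := by
    ext a; simp
  rw [h1] at hsum
  have h2 := sum_xlogx_avgSub_le K (fun X => (hu X).le)
  simp_rw [huK] at h2
  linarith

end Chain

/-! ### Entropy loss under a random matching -/

section RandomMatching

variable {V : Type*} [DecidableEq V] {C : Type*} [Fintype C]
variable {n : ℕ} {L : Finset V} {e : Fin n → V}

/-- The conditional mean of `h c` given that `m c = j`, where `m c` is uniform on `n` values. -/
noncomputable def condMean (w : C → ℝ) (m : C → V) (n : ℕ)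
    (h : C → Equiv.Perm V → ℝ) (j : V) (X : Equiv.Perm V) : ℝ :=
  ∑ c, (w c * (if m c = j then 1 else 0) * n) * h c X

theorem sum_indicator_mul {w : C → ℝ} {m : C → V} (hm : ∀ c, m c ∈ L) (hn : 0 < n)
    (F : V → C → ℝ) :
    ∑ j ∈ L, (n : ℝ)⁻¹ * ∑ c, (w c * (if m c = j then 1 else 0) * n) * F j c
      = ∑ c, w c * F (m c) c := by
  have hn' : (n : ℝ) ≠ 0 := by positivity
  simp_rw [Finset.mul_sum]
  rw [Finset.sum_comm]
  refine Finset.sum_congr rfl fun c _ => ?_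
  rw [Finset.sum_eq_single_of_mem (m c) (hm c)]
  · simp; field_simp
  · intro j _ hj
    simp [hj.symm]

theorem condMean_pos {w : C → ℝ} (hw : ∀ c, 0 ≤ w c) {m : C → V}
    (hmarg : ∀ F : V → ℝ, ∑ c, w c * F (m c) = (n : ℝ)⁻¹ * ∑ j ∈ L, F j) (hn : 0 < n)
    {h : C → Equiv.Perm V → ℝ} (hh : ∀ c X, 0 < h c X) {j : V} (hj : j ∈ L)
    (X : Equiv.Perm V) : 0 < condMean w m n h j X := by
  have hterm : ∀ c, 0 ≤ (w c * (if m c = j then 1 else 0) * n) * h c X := fun c => by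
    have := hw c; have := hh c X; split_ifs <;> positivity
  refine lt_of_le_of_ne (Finset.sum_nonneg fun c _ => hterm c) fun h0 => ?_
  have h1 := (Finset.sum_eq_zero_iff_of_nonneg fun c _ => hterm c).1 h0.symm
  have h2 := hmarg fun x => if x = j then 1 else 0
  have h3 : ∑ c, w c * (if m c = j then (1 : ℝ) else 0) = 0 := by
    refine Finset.sum_eq_zero fun c hc => ?_
    rcases mul_eq_zero.1 (h1 c hc) with h4 | h4
    · rcases mul_eq_zero.1 h4 with h5 | h5
      · exact h5
      · exact absurd h5 (by positivity)
    · exact absurd h4 (hh c X).ne'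
  rw [h3, Finset.sum_ite_eq' L j, if_pos hj, mul_one] at h2
  have : (0 : ℝ) < (n : ℝ)⁻¹ := by positivity
  linarith

theorem sum_log_condMean_le {w : C → ℝ} (hw : ∀ c, 0 ≤ w c)
    {m : C → Fin n → V} (hm : ∀ c t, m c t ∈ L)
    (hmarg : ∀ t (F : V → ℝ), ∑ c, w c * F (m c t) = (n : ℝ)⁻¹ * ∑ j ∈ L, F j)
    (hfin : ∀ g : Fin n → V → ℝ, (∀ t j, 0 ≤ g t j) → (∀ t, ∑ j ∈ L, g t j = n) →
      ∑ c, w c * ∏ t, √(g t (m c t)) ≤ 1)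
    {h : C → Equiv.Perm V → ℝ} (hh : ∀ c X, 0 < h c X) {nu : Equiv.Perm V → ℝ}
    (hnu : ∀ X, nu X = ∑ c, w c * h c X) (hnu0 : ∀ X, 0 < nu X) (X : Equiv.Perm V) :
    ∑ t, ∑ c, w c * (h c X * Real.log (condMean w (fun c => m c t) n h (m c t) X / nu X))
      ≤ 2 * ∑ c, w c * (h c X * Real.log (h c X / nu X)) := by
  classical
  set g : Fin n → V → ℝ := fun t j => condMean w (fun c => m c t) n h j X / nu X with hg
  have hgpos : ∀ t, ∀ j ∈ L, 0 < g t j := fun t j hj =>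
    div_pos (condMean_pos hw (hmarg t) t.pos hh hj X) (hnu0 X)
  have hg0 : ∀ t j, 0 ≤ g t j := fun t j => by
    refine div_nonneg (Finset.sum_nonneg fun c _ => ?_) (hnu0 X).le
    have := hw c; have := hh c X; split_ifs <;> positivity
  have hgsum : ∀ t, ∑ j ∈ L, g t j = n := fun t => by
    have hn : (0 : ℝ) < n := by exact_mod_cast t.pos
    have h1 := sum_indicator_mul (w := w) (m := fun c => m c t) (L := L) (fun c => hm c t) t.pos
      fun _ c => h c X
    rw [← Finset.mul_sum, ← hnu X] at h1
    simp only [hg]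
    rw [← Finset.sum_div, div_eq_iff (hnu0 X).ne', ← h1]
    unfold condMean
    rw [inv_mul_eq_div, mul_div_cancel₀ _ hn.ne']
  have hF := hfin g hg0 hgsum
  set q : C → ℝ := fun c => ∏ t, √(g t (m c t)) with hq
  have hqpos : ∀ c, 0 < q c := fun c =>
    Finset.prod_pos fun t _ => Real.sqrt_pos.2 (hgpos t _ (hm c t))
  have hlogq : ∀ c, Real.log (q c) = (1 / 2) * ∑ t, Real.log (g t (m c t)) := fun c => by
    rw [hq, Real.log_prod fun t _ => (Real.sqrt_pos.2 (hgpos t _ (hm c t))).ne', Finset.mul_sum]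
    refine Finset.sum_congr rfl fun t _ => ?_
    rw [Real.log_sqrt (hg0 _ _)]; ring
  have h1 : ∀ c, w c * (h c X - nu X * q c)
      ≤ w c * (h c X * (Real.log (h c X / nu X) - Real.log (q c))) := fun c => by
    refine mul_le_mul_of_nonneg_left ?_ (hw c)
    have h2 := log_sub_add_nonneg (hh c X) (mul_pos (hnu0 X) (hqpos c))
    rwa [← div_div, Real.log_div (div_pos (hh c X) (hnu0 X)).ne' (hqpos c).ne'] at h2
  have h2 := Finset.sum_le_sum fun c (_ : c ∈ Finset.univ) => h1 c
  have h3 : ∑ c, w c * (h c X - nu X * q c) = nu X - nu X * ∑ c, w c * q c := by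
    calc ∑ c, w c * (h c X - nu X * q c)
        = ∑ c, w c * h c X - ∑ c, nu X * (w c * q c) := by
          rw [← Finset.sum_sub_distrib]
          exact Finset.sum_congr rfl fun _ _ => by ring
      _ = _ := by rw [← hnu, Finset.mul_sum]
  have h4 : ∑ c, w c * (h c X * (Real.log (h c X / nu X) - Real.log (q c)))
      = ∑ c, w c * (h c X * Real.log (h c X / nu X))
        - (1 / 2) * ∑ t, ∑ c, w c * (h c X * Real.log (g t (m c t))) := by
    rw [Finset.sum_comm, Finset.mul_sum, ← Finset.sum_sub_distrib]
    refine Finset.sum_congr rfl fun c _ => ?_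
    rw [hlogq, ← Finset.mul_sum, ← Finset.mul_sum]
    ring
  have h5 : 0 ≤ nu X - nu X * ∑ c, w c * q c := by
    have := mul_le_mul_of_nonneg_left hF (hnu0 X).le
    linarith
  linarith

variable [Fintype V]

theorem sum_log_chain_le (he : Function.Injective e) (hd : ∀ t, e t ∉ L) (hL : L.card = n)
    {nu : Equiv.Perm V → ℝ} (hnu : ∀ X, 0 < nu X) {D : ℕ} (hD : 1 ≤ D) (hn : 2 * n ≤ 2 ^ D) :
    ∑ X, nu X * Real.log (avgSub (permsOn L) nu X / avgSub (permsOn (siteChain L e n)) nu X)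
      ≤ 36 * D * ∑ t : Fin n,
        hel (avgSub (permsOn (siteChain L e t)) nu) (swapMean L e nu t) := by
  classical
  set P : ℕ → Equiv.Perm V → ℝ := fun t => avgSub (permsOn (siteChain L e t)) nu with hP
  have hPpos : ∀ t X, 0 < P t X := fun t X => avgSub_pos _ hnu X
  have htel : ∀ X, nu X * Real.log (avgSub (permsOn L) nu X /
      avgSub (permsOn (siteChain L e n)) nu X)
      = ∑ t : Fin n, nu X * Real.log (P t X / P (t + 1) X) := by
    intro X
    rw [← Finset.mul_sum, Fin.sum_univ_eq_sum_range (fun t => Real.log (P t X / P (t + 1) X))]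
    have h1 : ∀ t ∈ Finset.range n, Real.log (P t X / P (t + 1) X)
        = Real.log (P t X) - Real.log (P (t + 1) X) := fun t _ =>
      Real.log_div (hPpos _ _).ne' (hPpos _ _).ne'
    rw [Finset.sum_congr rfl h1, Finset.sum_range_sub',
      ← Real.log_div (hPpos _ _).ne' (hPpos _ _).ne']
    simp only [hP, siteChain_zero]
  simp_rw [htel]
  rw [Finset.sum_comm]
  have hstep : ∀ t : Fin n, ∑ X, nu X * Real.log (P t X / P (t + 1) X)
      ≤ 9 * D * hel (P t) (P (t + 1)) := by
    intro t
    have h1 : ∑ X, nu X * Real.log (P t X / P (t + 1) X)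
        = ∑ X, P t X * Real.log (P t X / P (t + 1) X) := by
      rw [hP]
      rw [sum_avgSub_mul]
      refine Finset.sum_congr rfl fun X _ => ?_
      rw [avgSub_of_invariant]
      intro k hk Y
      simp only
      rw [avgSub_apply_mul _ hk, avgSub_apply_mul _
        (permsOn_mono (siteChain_mono (Nat.le_succ _)) hk)]
    have h2 : ∑ X, P t X = ∑ X, P (t + 1) X := by
      simp only [hP]
      rw [sum_avgSub, sum_avgSub]
    have h3 : ∀ X, P t X ≤ 2 ^ D * P (t + 1) X := by
      intro X
      have h4 : P (t + 1) X = ∑ l ∈ insert (e t) (siteChain L e t),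
          (((siteChain L e t).card : ℝ) + 1)⁻¹ *
            avgSub (permsOn (siteChain L e t)) (fun Y => nu (Equiv.swap (e t) l * Y)) X := by
        simp only [hP]
        rw [siteChain_succ, avgSub_permsOn_insert (notMem_siteChain he hd t le_rfl)]
      have h5 : (((siteChain L e t).card : ℝ) + 1)⁻¹ * P t X ≤ P (t + 1) X := by
        rw [h4]
        refine le_trans (le_of_eq ?_) (Finset.single_le_sum
          (f := fun l => (((siteChain L e t).card : ℝ) + 1)⁻¹ *
            avgSub (permsOn (siteChain L e t)) (fun Y => nu (Equiv.swap (e t) l * Y)) X)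
          (fun l _ => mul_nonneg (by positivity) (avgSub_nonneg _ (fun Y => (hnu _).le) _))
          (Finset.mem_insert_self (e t) _))
        simp only [Equiv.swap_self]
        rfl
      rw [inv_mul_le_iff₀ (by positivity)] at h5
      refine h5.trans (mul_le_mul_of_nonneg_right ?_ (hPpos _ _).le)
      rw [card_siteChain he hd hL]
      have : n + t + 1 ≤ 2 ^ D := by have := t.2; omega
      exact_mod_cast this
    rw [h1]
    calc ∑ X, P t X * Real.log (P t X / P (t + 1) X)
        = ∑ X, (P t X * Real.log (P t X / P (t + 1) X) - P t X + P (t + 1) X) := by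
          rw [Finset.sum_add_distrib, Finset.sum_sub_distrib, h2]; ring
      _ ≤ ∑ X, 9 * D * (√(P t X) - √(P (t + 1) X)) ^ 2 := Finset.sum_le_sum fun X _ =>
          log_le_sq_sqrt_sub (hPpos _ _) (hPpos _ _) hD (h3 X)
      _ = 9 * D * hel (P t) (P (t + 1)) := by rw [← Finset.mul_sum]; rfl
  refine (Finset.sum_le_sum fun t _ => hstep t).trans ?_
  rw [← Finset.mul_sum]
  have := sum_hel_chain_le he hd hL (fun X => (hnu X).le)
  have hD0 : (0 : ℝ) ≤ 9 * D := by positivity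
  calc _ ≤ 9 * D * (4 * ∑ t : Fin n,
        hel (avgSub (permsOn (siteChain L e t)) nu) (swapMean L e nu t)) :=
        mul_le_mul_of_nonneg_left this hD0
    _ = _ := by ring

theorem hel_swapMean_le {w : C → ℝ} (hw : ∀ c, 0 ≤ w c) (hL : L.card = n)
    {m : C → V} (hm : ∀ c, m c ∈ L)
    (hmarg : ∀ F : V → ℝ, ∑ c, w c * F (m c) = (n : ℝ)⁻¹ * ∑ j ∈ L, F j)
    {h : C → Equiv.Perm V → ℝ} (hh : ∀ c X, 0 < h c X) {nu : Equiv.Perm V → ℝ}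
    (hnu : ∀ X, nu X = ∑ c, w c * h c X) (hnu0 : ∀ X, 0 < nu X) (t : Fin n) :
    hel (avgSub (permsOn (siteChain L e t)) nu) (swapMean L e nu t)
      ≤ 6 * (∑ X, ∑ c, w c * (h c X * Real.log (condMean w m n h (m c) X / nu X)))
        + 3 * ∑ c, w c * hel (avgSub (permsOn (siteChain L e t)) (h c))
          (avgSub (permsOn (siteChain L e t)) fun Y => h c (Equiv.swap (e t) (m c) * Y)) := by
  classical
  have hn : 0 < n := t.pos
  have hn' : (n : ℝ) ≠ 0 := by positivity
  set H := condMean w m n h with hH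
  have hHpos : ∀ j ∈ L, ∀ X, 0 < H j X := fun j hj X => condMean_pos hw hmarg hn hh hj X
  have hHsum : ∀ X, ∑ j ∈ L, (n : ℝ)⁻¹ * H j X = nu X := fun X => by
    rw [hnu]; exact sum_indicator_mul hm hn fun _ c => h c X
  set P : (Equiv.Perm V → ℝ) → Equiv.Perm V → ℝ := avgSub (permsOn (siteChain L e t)) with hP
  have h1 : hel (P nu) (swapMean L e nu t)
      ≤ ∑ j ∈ L, (n : ℝ)⁻¹ * hel (P nu) (P fun Y => nu (Equiv.swap (e t) j * Y)) := by
    have h2 : P nu = fun X => ∑ j ∈ L, (n : ℝ)⁻¹ * P nu X := by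
      funext X
      rw [Finset.sum_const, hL, nsmul_eq_mul]; field_simp
    conv_lhs => rw [h2]
    exact hel_sum_le L (a := fun _ => P nu)
      (b := fun j => P fun Y => nu (Equiv.swap (e t) j * Y)) (fun _ => by positivity)
      (fun _ X => avgSub_nonneg _ (fun Y => (hnu0 Y).le) X)
      (fun _ X => avgSub_nonneg _ (fun Y => (hnu0 _).le) X)
  have h2 : ∀ j ∈ L, hel (P nu) (P fun Y => nu (Equiv.swap (e t) j * Y))
      ≤ 6 * hel (H j) nu
        + 3 * ∑ c, (w c * (if m c = j then 1 else 0) * n) *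
          hel (P (h c)) (P fun Y => h c (Equiv.swap (e t) j * Y)) := by
    intro j hj
    refine (hel_triangle₃ _ (P (H j)) (P fun Y => H j (Equiv.swap (e t) j * Y)) _).trans ?_
    have h3 : hel (P nu) (P (H j)) ≤ hel (H j) nu := by
      rw [hel_comm]
      exact hel_avgSub_le _ (fun X => (hHpos j hj X).le) (fun X => (hnu0 X).le)
    have h4 : hel (P fun Y => H j (Equiv.swap (e t) j * Y))
        (P fun Y => nu (Equiv.swap (e t) j * Y)) ≤ hel (H j) nu := by
      refine (hel_avgSub_le _ (fun X => (hHpos j hj _).le) (fun X => (hnu0 _).le)).trans ?_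
      exact (hel_comp_equiv (Equiv.mulLeft (Equiv.swap (e t) j)) (H j) nu).le
    have h5 : hel (P (H j)) (P fun Y => H j (Equiv.swap (e t) j * Y))
        ≤ ∑ c, (w c * (if m c = j then 1 else 0) * n) *
          hel (P (h c)) (P fun Y => h c (Equiv.swap (e t) j * Y)) := by
      have h6 : P (H j) = fun X => ∑ c, (w c * (if m c = j then 1 else 0) * n) * P (h c) X := by
        funext X
        exact avgSub_sum _ _ _ _ _
      have h7 : (P fun Y => H j (Equiv.swap (e t) j * Y)) = fun X =>
          ∑ c, (w c * (if m c = j then 1 else 0) * n) *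
            P (fun Y => h c (Equiv.swap (e t) j * Y)) X := by
        funext X
        exact avgSub_sum _ _ _ (fun c Y => h c (Equiv.swap (e t) j * Y)) _
      rw [h6, h7]
      exact hel_sum_le _ (fun c => by have := hw c; split_ifs <;> positivity)
        (fun c X => avgSub_nonneg _ (fun Y => (hh c Y).le) X)
        (fun c X => avgSub_nonneg _ (fun Y => (hh c _).le) X)
    linarith
  have h3 : ∑ j ∈ L, (n : ℝ)⁻¹ * hel (H j) nu
      ≤ ∑ X, ∑ c, w c * (h c X * Real.log (H (m c) X / nu X)) := by
    unfold hel
    simp_rw [Finset.mul_sum]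
    rw [Finset.sum_comm]
    refine Finset.sum_le_sum fun X _ => ?_
    calc ∑ j ∈ L, (n : ℝ)⁻¹ * (√(H j X) - √(nu X)) ^ 2
        ≤ ∑ j ∈ L, (n : ℝ)⁻¹ * (H j X * Real.log (H j X / nu X) - H j X + nu X) :=
          Finset.sum_le_sum fun j hj => mul_le_mul_of_nonneg_left
            (sq_sqrt_sub_le_log (hHpos j hj X) (hnu0 X)) (by positivity)
      _ = ∑ j ∈ L, (n : ℝ)⁻¹ * (H j X * Real.log (H j X / nu X))
          - ∑ j ∈ L, (n : ℝ)⁻¹ * H j X + ∑ j ∈ L, (n : ℝ)⁻¹ * nu X := by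
          rw [← Finset.sum_sub_distrib, ← Finset.sum_add_distrib]
          exact Finset.sum_congr rfl fun _ _ => by ring
      _ = ∑ j ∈ L, (n : ℝ)⁻¹ * (H j X * Real.log (H j X / nu X)) := by
          rw [hHsum, Finset.sum_const, hL, nsmul_eq_mul]; field_simp; ring
      _ = ∑ c, w c * (h c X * Real.log (H (m c) X / nu X)) := by
          rw [← sum_indicator_mul hm hn fun j c => h c X * Real.log (H j X / nu X)]
          refine Finset.sum_congr rfl fun j _ => ?_
          congr 1
          rw [hH]
          unfold condMean
          rw [Finset.sum_mul]
          exact Finset.sum_congr rfl fun c _ => by ring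
  have h4 := sum_indicator_mul (w := w) hm hn fun j c =>
    hel (P (h c)) (P fun Y => h c (Equiv.swap (e t) j * Y))
  calc hel (P nu) (swapMean L e nu t)
      ≤ ∑ j ∈ L, (n : ℝ)⁻¹ * (6 * hel (H j) nu
        + 3 * ∑ c, (w c * (if m c = j then 1 else 0) * n) *
          hel (P (h c)) (P fun Y => h c (Equiv.swap (e t) j * Y))) :=
        h1.trans (Finset.sum_le_sum fun j hj =>
          mul_le_mul_of_nonneg_left (h2 j hj) (by positivity))
    _ = 6 * ∑ j ∈ L, (n : ℝ)⁻¹ * hel (H j) nu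
        + 3 * ∑ j ∈ L, (n : ℝ)⁻¹ * ∑ c, (w c * (if m c = j then 1 else 0) * n) *
          hel (P (h c)) (P fun Y => h c (Equiv.swap (e t) j * Y)) := by
        rw [Finset.mul_sum, Finset.mul_sum, ← Finset.sum_add_distrib]
        exact Finset.sum_congr rfl fun _ _ => by ring
    _ ≤ _ := by rw [h4]; linarith

/-- If `h` is a joint density of an arrangement and a random matching, then the entropy that the
sites of `e` carry is controlled by the dependence on the matching and the entropy lost when
averaging over the matching. -/
theorem entropy_le_of_random_matching {w : C → ℝ} (hw : ∀ c, 0 ≤ w c)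
    (he : Function.Injective e) (hd : ∀ t, e t ∉ L) (hL : L.card = n)
    {m : C → Fin n → V} (hm : ∀ c t, m c t ∈ L) (hmi : ∀ c, Function.Injective (m c))
    (hmarg : ∀ t (F : V → ℝ), ∑ c, w c * F (m c t) = (n : ℝ)⁻¹ * ∑ j ∈ L, F j)
    (hfin : ∀ g : Fin n → V → ℝ, (∀ t j, 0 ≤ g t j) → (∀ t, ∑ j ∈ L, g t j = n) →
      ∑ c, w c * ∏ t, √(g t (m c t)) ≤ 1)
    {K : C → Subgroup (Equiv.Perm V)} (hK : ∀ c t, Equiv.swap (e t) (m c t) ∈ K c)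
    {h : C → Equiv.Perm V → ℝ} (hh : ∀ c X, 0 < h c X) {nu : Equiv.Perm V → ℝ}
    (hnu : ∀ X, nu X = ∑ c, w c * h c X) (hnu0 : ∀ X, 0 < nu X)
    {D : ℕ} (hD : 1 ≤ D) (hn : 2 * n ≤ 2 ^ D) :
    ∑ X, nu X * Real.log (avgSub (permsOn L) nu X / avgSub (permsOn (siteChain L e n)) nu X)
      ≤ 432 * D * (∑ X, ∑ c, w c * (h c X * Real.log (h c X / nu X))
        + ∑ c, w c * (∑ X, xlogx (h c X) - ∑ X, xlogx (avgSub (K c) (h c) X))) := by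
  classical
  refine (sum_log_chain_le he hd hL hnu0 hD hn).trans ?_
  have h1 : ∑ t : Fin n, hel (avgSub (permsOn (siteChain L e t)) nu) (swapMean L e nu t)
      ≤ 6 * (∑ X, ∑ t, ∑ c, w c *
          (h c X * Real.log (condMean w (fun c => m c t) n h (m c t) X / nu X)))
        + 3 * ∑ c, w c * ∑ t : Fin n, hel (avgSub (permsOn (siteChain L e t)) (h c))
          (avgSub (permsOn (siteChain L e t)) fun Y => h c (Equiv.swap (e t) (m c t) * Y)) := by
    refine (Finset.sum_le_sum fun t _ => hel_swapMean_le (m := fun c => m c t) hw hL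
      (fun c => hm c t) (hmarg t) hh hnu hnu0 t).trans (le_of_eq ?_)
    rw [Finset.sum_add_distrib, ← Finset.mul_sum, ← Finset.mul_sum, Finset.sum_comm]
    congr 2
    rw [Finset.sum_comm]
    exact Finset.sum_congr rfl fun c _ => by rw [Finset.mul_sum]
  have h2 : ∑ X, ∑ t, ∑ c, w c *
      (h c X * Real.log (condMean w (fun c => m c t) n h (m c t) X / nu X))
      ≤ 2 * ∑ X, ∑ c, w c * (h c X * Real.log (h c X / nu X)) := by
    rw [Finset.mul_sum]
    exact Finset.sum_le_sum fun X _ => sum_log_condMean_le hw hm hmarg hfin hh hnu hnu0 X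
  have h3 : ∑ c, w c * ∑ t : Fin n, hel (avgSub (permsOn (siteChain L e t)) (h c))
        (avgSub (permsOn (siteChain L e t)) fun Y => h c (Equiv.swap (e t) (m c t) * Y))
      ≤ 4 * ∑ c, w c * (∑ X, xlogx (h c X) - ∑ X, xlogx (avgSub (K c) (h c) X)) := by
    rw [Finset.mul_sum]
    refine Finset.sum_le_sum fun c _ => ?_
    have := mul_le_mul_of_nonneg_left
      (sum_hel_matching_le he hd (hm c) (hmi c) (hK c) (hh c)) (hw c)
    linarith
  have hD0 : (0 : ℝ) ≤ D := by positivity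
  calc _ ≤ 36 * D * (12 * (∑ X, ∑ c, w c * (h c X * Real.log (h c X / nu X))
        + ∑ c, w c * (∑ X, xlogx (h c X) - ∑ X, xlogx (avgSub (K c) (h c) X)))) :=
        mul_le_mul_of_nonneg_left (by linarith) (by positivity)
    _ = _ := by ring

end RandomMatching

/-! ### Sweeps of the hypercube -/

section Sweep

open scoped BigOperators

variable {d : ℕ}

theorem flipCoord_same (j : Fin d) (x : Cube d) : flipCoord j x j = !x j := by
  simp [flipCoord]

theorem flipCoord_of_ne {j t : Fin d} (h : t ≠ j) (x : Cube d) : flipCoord j x t = x t := by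
  simp [flipCoord, h]

theorem flipCoord_ne (j : Fin d) (x : Cube d) : flipCoord j x ≠ x := fun h => by
  have := congrFun h j
  rw [flipCoord_same] at this
  simp at this

theorem switchEdges_apply (j : Fin d) (c : DirEdge j → Bool) (x : Cube d) :
    switchEdges j c x = if c (edgeAt j x) = true then flipCoord j x else x := rfl

theorem edgeAt_coe (j : Fin d) (e : DirEdge j) : edgeAt j e.1 = e := by
  refine Subtype.ext ?_
  funext t
  by_cases h : t = j
  · subst h; simp [edgeAt, e.2]
  · simp [edgeAt, h]

theorem edgeAt_switchEdges (j : Fin d) (c : DirEdge j → Bool) (x : Cube d) :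
    edgeAt j (switchEdges j c x) = edgeAt j x := by
  rw [switchEdges_apply]
  split_ifs
  · exact edgeAt_flipCoord j x
  · rfl

theorem switchEdges_of_ne {j t : Fin d} (h : t ≠ j) (c : DirEdge j → Bool) (x : Cube d) :
    switchEdges j c x t = x t := by
  rw [switchEdges_apply]
  split_ifs
  · exact flipCoord_of_ne h x
  · rfl

theorem switchEdges_mul (j : Fin d) (c c' : DirEdge j → Bool) :
    switchEdges j c * switchEdges j c' = switchEdges j fun e => xor (c e) (c' e) := by
  ext1 x
  rw [Equiv.Perm.mul_apply, switchEdges_apply, edgeAt_switchEdges, switchEdges_apply,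
    switchEdges_apply]
  cases c (edgeAt j x) <;> cases c' (edgeAt j x) <;> simp [flipCoord_flipCoord]

theorem switchEdges_false (j : Fin d) : switchEdges j (fun _ => false) = 1 := by
  ext1 x; simp [switchEdges_apply]

theorem switchEdges_inv (j : Fin d) (c : DirEdge j → Bool) :
    (switchEdges j c)⁻¹ = switchEdges j c := by
  rw [inv_eq_iff_mul_eq_one, switchEdges_mul, ← switchEdges_false j]
  simp

theorem switchEdges_injective (j : Fin d) :
    Function.Injective (switchEdges j : (DirEdge j → Bool) → Equiv.Perm (Cube d)) := by
  intro c c' h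
  funext e
  have := congrArg (fun g : Equiv.Perm (Cube d) => g e.1) h
  simp only [switchEdges_apply, edgeAt_coe] at this
  have hne := flipCoord_ne j e.1
  cases h1 : c e <;> cases h2 : c' e <;> rw [h1, h2] at this
  · exact absurd (by simpa using this.symm) hne
  · exact absurd (by simpa using this) hne

/-- The group of all switches of edges in direction `j`. -/
def switchSub (j : Fin d) : Subgroup (Equiv.Perm (Cube d)) where
  carrier := Set.range (switchEdges j)
  one_mem' := ⟨_, switchEdges_false j⟩
  mul_mem' := by
    rintro _ _ ⟨c, rfl⟩ ⟨c', rfl⟩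
    exact ⟨_, (switchEdges_mul j c c').symm⟩
  inv_mem' := by
    rintro _ ⟨c, rfl⟩
    exact ⟨c, (switchEdges_inv j c).symm⟩

theorem swap_flipCoord_mem (j : Fin d) (y : Cube d) :
    Equiv.swap y (flipCoord j y) ∈ switchSub j := by
  refine ⟨fun e => decide (e = edgeAt j y), ?_⟩
  ext1 x
  rw [switchEdges_apply, Equiv.swap_apply_def]
  by_cases h1 : x = y
  · simp [h1]
  · by_cases h2 : x = flipCoord j y
    · simp [h2, edgeAt_flipCoord, flipCoord_flipCoord, flipCoord_ne]
    · have h3 : edgeAt j x ≠ edgeAt j y := by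
        intro h
        have h4 : ∀ t, t ≠ j → x t = y t := fun t ht => by
          have := congrFun (congrArg Subtype.val h) t
          simpa [edgeAt, ht] using this
        by_cases h5 : x j = y j
        · exact h1 (funext fun t => by
            by_cases ht : t = j
            · rw [ht, h5]
            · exact h4 t ht)
        · refine h2 (funext fun t => ?_)
          by_cases ht : t = j
          · rw [ht, flipCoord_same]
            cases hx : x j <;> cases hy : y j <;> simp_all
          · rw [flipCoord_of_ne ht, h4 t ht]
      simp [h1, h2, h3]

theorem expect_switchEdges (j : Fin d) (F : Equiv.Perm (Cube d) → ℝ) (X : Equiv.Perm (Cube d)) :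
    𝔼 κ : DirEdge j → Bool, F (switchEdges j κ * X) = avgSub (switchSub j) F X := by
  classical
  let E : (DirEdge j → Bool) ≃ switchSub j :=
    Equiv.ofInjective (switchEdges j) (switchEdges_injective j)
  have hcard : Fintype.card (DirEdge j → Bool) = Fintype.card (switchSub j) :=
    Fintype.card_congr E
  rw [Fintype.expect_eq_sum_div_card, hcard, Finset.sum_div, avgSub]
  refine Fintype.sum_equiv E _ _ fun κ => ?_
  rw [div_eq_inv_mul]
  congr 2

/-- The coins for one sweep through all directions. -/
abbrev Coins (d : ℕ) : Type := ∀ t : Fin d, DirEdge t → Bool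

/-- The permutation of positions after the switches in the first `s` directions. -/
def sweep (c : Coins d) : ℕ → Equiv.Perm (Cube d)
  | 0 => 1
  | s + 1 => (if h : s < d then switchEdges ⟨s, h⟩ (c ⟨s, h⟩) else 1) * sweep c s

theorem sweep_succ (c : Coins d) (s : Fin d) :
    sweep c (s + 1) = switchEdges s (c s) * sweep c s := by
  simp [sweep]

theorem sweep_congr {c c' : Coins d} {s : ℕ} (h : ∀ t : Fin d, (t : ℕ) < s → c t = c' t) :
    sweep c s = sweep c' s := by
  induction s with
  | zero => rfl
  | succ s ih =>
    unfold sweep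
    rw [ih fun t ht => h t (ht.trans (Nat.lt_succ_self s))]
    split_ifs with hs
    · rw [h ⟨s, hs⟩ (Nat.lt_succ_self s)]
    · rfl

theorem sweep_apply_of_le (c : Coins d) {s : ℕ} {t : Fin d} (h : s ≤ t) (x : Cube d) :
    sweep c s x t = x t := by
  induction s with
  | zero => rfl
  | succ s ih =>
    have hs : s < d := by have := t.2; omega
    rw [sweep_succ c ⟨s, hs⟩, Equiv.Perm.mul_apply, switchEdges_of_ne, ih (by omega)]
    rintro rfl
    simp at h

theorem sweep_inv_apply_of_le (c : Coins d) {s : ℕ} {t : Fin d} (h : s ≤ t) (x : Cube d) :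
    (sweep c s)⁻¹ x t = x t := by
  rw [← sweep_apply_of_le c h ((sweep c s)⁻¹ x), Equiv.Perm.coe_inv, Equiv.apply_symm_apply]

theorem expect_update {ι : Type*} [Fintype ι] [DecidableEq ι] {β : ι → Type*}
    [∀ i, Fintype (β i)] [∀ i, Nonempty (β i)] (i : ι) (F : (∀ i, β i) → ℝ) :
    𝔼 c, F c = 𝔼 c, 𝔼 κ : β i, F (Function.update c i κ) := by
  let E : (∀ i, β i) × β i ≃ (∀ i, β i) × β i :=
    { toFun := fun p => (Function.update p.1 i p.2, p.1 i)
      invFun := fun p => (Function.update p.1 i p.2, p.1 i)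
      left_inv := fun p => by simp
      right_inv := fun p => by simp }
  rw [← Finset.expect_product' Finset.univ Finset.univ fun c κ => F (Function.update c i κ),
    Finset.univ_product_univ]
  rw [Fintype.expect_equiv E (fun p => F (Function.update p.1 i p.2)) (fun p => F p.1)
    (fun _ => rfl), ← Finset.univ_product_univ,
    Finset.expect_product' Finset.univ Finset.univ fun c (_ : β i) => F c]
  simp

/-- The coins of `c` on the edges with `true` in coordinate `s` and those of `c'` elsewhere. -/
def mixCoins (s : Fin d) (c c' : Coins d) : Coins d := fun t e => if e.1 s then c t e else c' t e

theorem expect_mixCoins (s : Fin d) (F : Coins d → ℝ) :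
    𝔼 c, F c = 𝔼 c', 𝔼 c, F (mixCoins s c c') := by
  let E : Coins d × Coins d ≃ Coins d × Coins d :=
    { toFun := fun p => (mixCoins s p.1 p.2, mixCoins s p.2 p.1)
      invFun := fun p => (mixCoins s p.1 p.2, mixCoins s p.2 p.1)
      left_inv := fun p => by
        ext t e <;> simp only [mixCoins] <;> split_ifs <;> rfl
      right_inv := fun p => by
        ext t e <;> simp only [mixCoins] <;> split_ifs <;> rfl }
  rw [Finset.expect_comm, ← Finset.expect_product' Finset.univ Finset.univ
    fun c c' => F (mixCoins s c c'), Finset.univ_product_univ]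
  rw [Fintype.expect_equiv E (fun p => F (mixCoins s p.1 p.2)) (fun p => F p.1)
    (fun _ => rfl), ← Finset.univ_product_univ,
    Finset.expect_product' Finset.univ Finset.univ fun c (_ : Coins d) => F c]
  simp

theorem sweep_mixCoins_apply_true {s : Fin d} (c c' : Coins d) {k : ℕ} (hk : k ≤ s)
    {x : Cube d} (hx : x s = true) : sweep (mixCoins s c c') k x = sweep c k x := by
  induction k with
  | zero => rfl
  | succ k ih =>
    have hkd : k < d := by have := s.2; omega
    have hne : s ≠ ⟨k, hkd⟩ := fun h => by rw [h] at hk; simp at hk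
    rw [sweep_succ _ ⟨k, hkd⟩, sweep_succ _ ⟨k, hkd⟩, Equiv.Perm.mul_apply,
      Equiv.Perm.mul_apply, ih (by omega), switchEdges_apply, switchEdges_apply]
    have : (edgeAt ⟨k, hkd⟩ (sweep c k x)).1 s = true := by
      simp only [edgeAt, Function.update_of_ne hne]
      rw [sweep_apply_of_le c (by omega), hx]
    simp [mixCoins, this]

theorem sweep_mixCoins_apply_false {s : Fin d} (c c' : Coins d) {k : ℕ} (hk : k ≤ s)
    {x : Cube d} (hx : x s = false) : sweep (mixCoins s c c') k x = sweep c' k x := by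
  induction k with
  | zero => rfl
  | succ k ih =>
    have hkd : k < d := by have := s.2; omega
    have hne : s ≠ ⟨k, hkd⟩ := fun h => by rw [h] at hk; simp at hk
    rw [sweep_succ _ ⟨k, hkd⟩, sweep_succ _ ⟨k, hkd⟩, Equiv.Perm.mul_apply,
      Equiv.Perm.mul_apply, ih (by omega), switchEdges_apply, switchEdges_apply]
    have : (edgeAt ⟨k, hkd⟩ (sweep c' k x)).1 s = false := by
      simp only [edgeAt, Function.update_of_ne hne]
      rw [sweep_apply_of_le c' (by omega), hx]
    simp [mixCoins, this]

/-- The site that meets the site `x` in direction `s` after the switches in the directions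
before `s`. -/
def sweepPartner (c : Coins d) (s : Fin d) (x : Cube d) : Cube d :=
  (sweep c s)⁻¹ (flipCoord s (sweep c s x))

theorem sweepPartner_injective (c : Coins d) (s : Fin d) :
    Function.Injective (sweepPartner c s) := by
  intro x y h
  have h1 := (sweep c s)⁻¹.injective h
  have h2 := congrArg (flipCoord s) h1
  rw [flipCoord_flipCoord, flipCoord_flipCoord] at h2
  exact (sweep c s).injective h2

theorem sweepPartner_mixCoins {s : Fin d} (c c' : Coins d) {x : Cube d} (hx : x s = true) :
    sweepPartner (mixCoins s c c') s x = (sweep c' s)⁻¹ (flipCoord s (sweep c s x)) := by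
  unfold sweepPartner
  rw [sweep_mixCoins_apply_true c c' le_rfl hx, Equiv.Perm.inv_eq_iff_eq]
  have : (sweep c' (s : ℕ))⁻¹ (flipCoord s (sweep c s x)) s = false := by
    rw [sweep_inv_apply_of_le c' le_rfl, flipCoord_same, sweep_apply_of_le c le_rfl, hx]
    rfl
  rw [sweep_mixCoins_apply_false c c' le_rfl this, Equiv.Perm.coe_inv, Equiv.apply_symm_apply]

/-- The average of `g` over an edge in direction `j`. -/
noncomputable def edgeMean (j : Fin d) (g : Cube d → ℝ) (y : Cube d) : ℝ :=
  (g y + g (flipCoord j y)) / 2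

/-- The average of `g` over the first `s` coordinates. -/
noncomputable def coordMean : ℕ → (Cube d → ℝ) → Cube d → ℝ
  | 0, g => g
  | s + 1, g => coordMean s (if h : s < d then edgeMean ⟨s, h⟩ g else g)

theorem coordMean_succ (s : Fin d) (g : Cube d → ℝ) :
    coordMean (s + 1) g = coordMean s (edgeMean s g) := by
  simp [coordMean]

theorem edgeMean_nonneg (j : Fin d) {g : Cube d → ℝ} (hg : ∀ y, 0 ≤ g y) (y : Cube d) :
    0 ≤ edgeMean j g y := by
  have := hg y; have := hg (flipCoord j y); unfold edgeMean; positivity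

/-- The sites that agree with `x` in all coordinates from `s` on. -/
def subcubeAt (s : ℕ) (x : Cube d) : Finset (Cube d) :=
  Finset.univ.filter fun y => ∀ t : Fin d, s ≤ t → y t = x t

theorem mem_subcubeAt {s : ℕ} {x y : Cube d} :
    y ∈ subcubeAt s x ↔ ∀ t : Fin d, s ≤ t → y t = x t := by
  simp [subcubeAt]

theorem subcubeAt_succ (s : Fin d) (x : Cube d) :
    subcubeAt (s + 1) x = subcubeAt s x ∪ (subcubeAt s x).image (flipCoord s) := by
  ext y
  simp only [Finset.mem_union, Finset.mem_image, mem_subcubeAt]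
  constructor
  · intro h
    by_cases hy : y s = x s
    · refine Or.inl fun t ht => ?_
      rcases ht.eq_or_lt with h1 | h1
      · rw [← Fin.ext h1, hy]
      · exact h t h1
    · refine Or.inr ⟨flipCoord s y, fun t ht => ?_, flipCoord_flipCoord s y⟩
      rcases ht.eq_or_lt with h1 | h1
      · rw [← Fin.ext h1, flipCoord_same]
        cases h2 : y s <;> cases h3 : x s <;> simp_all
      · rw [flipCoord_of_ne (fun h2 => by rw [h2] at h1; exact lt_irrefl _ h1)]
        exact h t h1
  · rintro (h | ⟨z, h, rfl⟩) t ht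
    · exact h t (by omega)
    · rw [flipCoord_of_ne (fun h2 => by rw [h2] at ht; omega)]
      exact h t (by omega)

theorem flipCoord_injective (s : Fin d) : Function.Injective (flipCoord s) :=
  fun x y h => by rw [← flipCoord_flipCoord s x, h, flipCoord_flipCoord]

theorem disjoint_subcubeAt_image (s : Fin d) (x : Cube d) :
    Disjoint (subcubeAt s x) ((subcubeAt s x).image (flipCoord s)) := by
  rw [Finset.disjoint_left]
  intro y hy hy'
  obtain ⟨z, hz, rfl⟩ := Finset.mem_image.1 hy'
  have h1 := mem_subcubeAt.1 hy s le_rfl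
  rw [flipCoord_same, mem_subcubeAt.1 hz s le_rfl] at h1
  simp at h1

theorem coordMean_eq {s : ℕ} (hs : s ≤ d) (g : Cube d → ℝ) (x : Cube d) :
    coordMean s g x = ((2 : ℝ) ^ s)⁻¹ * ∑ y ∈ subcubeAt s x, g y := by
  induction s generalizing g with
  | zero =>
    have : subcubeAt 0 x = {x} := by
      ext y
      simp only [mem_subcubeAt, Finset.mem_singleton]
      exact ⟨fun h => funext fun t => h t (Nat.zero_le _), fun h t _ => by rw [h]⟩
    simp [coordMean, this]
  | succ s ih =>
    have h1 := coordMean_succ ⟨s, hs⟩ g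
    have h2 := subcubeAt_succ ⟨s, hs⟩ x
    simp only at h1 h2
    rw [h1, ih (by omega), h2, Finset.sum_union (disjoint_subcubeAt_image ⟨s, hs⟩ x),
      Finset.sum_image fun a _ b _ h => flipCoord_injective _ h]
    unfold edgeMean
    rw [← Finset.sum_div, Finset.sum_add_distrib, pow_succ, mul_inv]
    ring

theorem card_subcubeAt {s : ℕ} (hs : s ≤ d) (x : Cube d) : (subcubeAt s x).card = 2 ^ s := by
  induction s with
  | zero =>
    have : subcubeAt 0 x = {x} := by
      ext y
      simp only [mem_subcubeAt, Finset.mem_singleton]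
      exact ⟨fun h => funext fun t => h t (Nat.zero_le _), fun h t _ => by rw [h]⟩
    simp [this]
  | succ s ih =>
    have h2 := subcubeAt_succ ⟨s, hs⟩ x
    simp only at h2
    rw [h2, Finset.card_union_of_disjoint (disjoint_subcubeAt_image ⟨s, hs⟩ x),
      Finset.card_image_of_injective _ (flipCoord_injective _), ih (by omega), pow_succ]
    ring

theorem expect_sweep {s : ℕ} (hs : s ≤ d) (g : Cube d → ℝ) (x : Cube d) :
    𝔼 c : Coins d, g (sweep c s x) = coordMean s g x := by
  induction s generalizing g with
  | zero => simp [sweep, coordMean]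
  | succ s ih =>
    set j : Fin d := ⟨s, hs⟩ with hj
    have h1 := coordMean_succ j g
    simp only [hj] at h1
    rw [h1, ← ih (by omega), expect_update j]
    refine Finset.expect_congr rfl fun c _ => ?_
    have h2 : ∀ κ : DirEdge j → Bool, sweep (Function.update c j κ) (s + 1) x
        = switchEdges j κ (sweep c s x) := by
      intro κ
      have h3 := sweep_succ (Function.update c j κ) j
      simp only [hj] at h3
      rw [h3, Function.update_self, Equiv.Perm.mul_apply]
      congr 2
      exact sweep_congr fun t ht => Function.update_of_ne (fun h => by rw [h, hj] at ht; simp at ht) _ _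
    simp_rw [h2]
    have h4 : 𝔼 κ : DirEdge j → Bool, g (switchEdges j κ (sweep c s x))
        = 𝔼 κ : DirEdge j → Bool, g (flipCoord j (switchEdges j κ (sweep c s x))) := by
      refine Fintype.expect_equiv (Equiv.arrowCongr (Equiv.refl (DirEdge j)) Equiv.boolNot) _ _ fun κ => ?_
      rw [switchEdges_apply, switchEdges_apply]
      cases h : κ (edgeAt j (sweep c s x)) <;> simp [h, flipCoord_flipCoord]
    have h5 : ∀ κ : DirEdge j → Bool, edgeMean j g (sweep c s x)
        = (g (switchEdges j κ (sweep c s x))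
          + g (flipCoord j (switchEdges j κ (sweep c s x)))) / 2 := by
      intro κ
      rw [switchEdges_apply, edgeMean]
      split_ifs
      · rw [flipCoord_flipCoord]; ring
      · rfl
    have h6 : 𝔼 κ : DirEdge j → Bool, edgeMean j g (sweep c s x)
        = 𝔼 κ : DirEdge j → Bool, (g (switchEdges j κ (sweep c s x))
          + g (flipCoord j (switchEdges j κ (sweep c s x)))) / 2 :=
      Finset.expect_congr rfl fun κ _ => h5 κ
    rw [Fintype.expect_const] at h6
    rw [h6, ← Finset.expect_div, Finset.expect_add_distrib, ← h4]
    ring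

end Sweep

section SweepMatching

open scoped BigOperators

variable {d : ℕ}

theorem prod_dirEdge (j : Fin d) (F : Cube d → ℝ) :
    ∏ y, F y = ∏ e : DirEdge j, F e.1 * F (flipCoord j e.1) := by
  rw [← Fintype.prod_subtype_mul_prod_subtype (fun y : Cube d => y j = false) F,
    Finset.prod_mul_distrib]
  congr 1
  symm
  refine Fintype.prod_equiv
    { toFun := fun e => ⟨flipCoord j e.1, by rw [flipCoord_same, e.2]; simp⟩
      invFun := fun e => ⟨flipCoord j e.1, by
        have := e.2
        rw [flipCoord_same]
        simpa using this⟩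
      left_inv := fun e => Subtype.ext (flipCoord_flipCoord j e.1)
      right_inv := fun e => Subtype.ext (flipCoord_flipCoord j e.1) } _ _ fun e => rfl

theorem sqrt_mul_add_sqrt_mul_le {p q r s : ℝ} (hp : 0 ≤ p) (hq : 0 ≤ q) (hr : 0 ≤ r)
    (hs : 0 ≤ s) :
    (√p * √q + √r * √s) / 2 ≤ √((r + p) / 2) * √((q + s) / 2) := by
  rw [← Real.sqrt_mul (by positivity : 0 ≤ (r + p) / 2)]
  apply Real.le_sqrt_of_sq_le
  have h1 := Real.sq_sqrt hp
  have h2 := Real.sq_sqrt hq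
  have h3 := Real.sq_sqrt hr
  have h4 := Real.sq_sqrt hs
  set P := √p
  set Q := √q
  set R := √r
  set S := √s
  rw [← h1, ← h2, ← h3, ← h4]
  nlinarith [sq_nonneg (P * S - R * Q)]

theorem expect_prod_dirEdge (j : Fin d) (f : DirEdge j → Bool → ℝ) :
    𝔼 κ : DirEdge j → Bool, ∏ e, f e (κ e) = ∏ e, (f e true + f e false) / 2 := by
  classical
  rw [Fintype.expect_eq_sum_div_card, Finset.prod_div_distrib, Finset.prod_const]
  congr 1
  · have := Finset.prod_univ_sum (fun _ : DirEdge j => (Finset.univ : Finset Bool)) f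
    rw [Fintype.piFinset_univ] at this
    rw [← this]
    exact Finset.prod_congr rfl fun e _ => by rw [Fintype.sum_bool]
  · simp

theorem expect_prod_sqrt_switchEdges_le (j : Fin d) {g : Cube d → Cube d → ℝ}
    (hg : ∀ x y, 0 ≤ g x y) :
    𝔼 κ : DirEdge j → Bool, ∏ y, √(g y (switchEdges j κ y))
      ≤ ∏ y, √(edgeMean j (g y) y) := by
  set f : DirEdge j → Bool → ℝ := fun e b =>
    √(g e.1 (if b = true then flipCoord j e.1 else e.1)) *
      √(g (flipCoord j e.1) (if b = true then e.1 else flipCoord j e.1)) with hf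
  have h1 : ∀ κ : DirEdge j → Bool, ∏ y, √(g y (switchEdges j κ y)) = ∏ e, f e (κ e) := by
    intro κ
    rw [prod_dirEdge j]
    refine Finset.prod_congr rfl fun e _ => ?_
    simp only [hf, switchEdges_apply, edgeAt_flipCoord, edgeAt_coe, flipCoord_flipCoord]
  rw [Finset.expect_congr rfl fun κ _ => h1 κ, expect_prod_dirEdge, prod_dirEdge j]
  refine Finset.prod_le_prod (fun e _ => by positivity) fun e _ => ?_
  simp only [hf, if_true, Bool.false_eq_true, if_false, edgeMean, flipCoord_flipCoord]
  rw [add_comm (g (flipCoord j e.1) (flipCoord j e.1))]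
  exact sqrt_mul_add_sqrt_mul_le (hg _ _) (hg _ _) (hg _ _) (hg _ _)

theorem expect_prod_sqrt_sweep_le {s : ℕ} (hs : s ≤ d) {g : Cube d → Cube d → ℝ}
    (hg : ∀ x y, 0 ≤ g x y) :
    𝔼 c : Coins d, ∏ x, √(g x (sweep c s x)) ≤ ∏ x, √(coordMean s (g x) x) := by
  induction s generalizing g with
  | zero => simp [sweep, coordMean]
  | succ s ih =>
    set j : Fin d := ⟨s, hs⟩ with hj
    have h1 : ∀ x, coordMean (s + 1) (g x) = coordMean s (edgeMean j (g x)) := fun x =>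
      coordMean_succ j (g x)
    simp_rw [h1]
    refine le_trans ?_ (ih (by omega) (g := fun x => edgeMean j (g x))
      fun x y => edgeMean_nonneg j (hg x) y)
    rw [expect_update j]
    refine Finset.expect_le_expect fun c _ => ?_
    have h2 : ∀ κ : DirEdge j → Bool, sweep (Function.update c j κ) (s + 1)
        = switchEdges j κ * sweep c s := by
      intro κ
      have h3 := sweep_succ (Function.update c j κ) j
      simp only [hj] at h3
      rw [h3, Function.update_self]
      congr 1
      exact sweep_congr fun t ht =>
        Function.update_of_ne (fun h => by rw [h, hj] at ht; simp at ht) _ _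
    have h3 := expect_prod_sqrt_switchEdges_le j (g := fun y => g ((sweep c s)⁻¹ y))
      fun x y => hg _ y
    have h4 : ∏ y, √(edgeMean j (g ((sweep c s)⁻¹ y)) y)
        = ∏ x, √(edgeMean j (g x) (sweep c s x)) := by
      refine (Fintype.prod_equiv (sweep c s) _ _ fun x => ?_).symm
      simp
    rw [← h4]
    refine le_trans (le_of_eq (Finset.expect_congr rfl fun κ _ => ?_)) h3
    rw [h2]
    refine Fintype.prod_equiv (sweep c s) _ _ fun x => ?_
    simp

theorem sum_partner (c : Coins d) (s : Fin d) (F : Cube d → ℝ) (x : Cube d) :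
    ∑ y ∈ subcubeAt s x, F ((sweep c s)⁻¹ (flipCoord s y))
      = ∑ j ∈ subcubeAt s (flipCoord s x), F j := by
  refine Finset.sum_bij' (fun y _ => (sweep c s)⁻¹ (flipCoord s y))
    (fun j _ => flipCoord s (sweep c s j)) ?_ ?_ ?_ ?_ (fun _ _ => rfl)
  · intro y hy
    rw [mem_subcubeAt] at hy ⊢
    intro t ht
    rw [sweep_inv_apply_of_le c ht]
    by_cases h : t = s
    · subst h; rw [flipCoord_same, flipCoord_same, hy t ht]
    · rw [flipCoord_of_ne h, flipCoord_of_ne h, hy t ht]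
  · intro y hy
    rw [mem_subcubeAt] at hy ⊢
    intro t ht
    have h1 := hy t ht
    by_cases h : t = s
    · subst h
      rw [flipCoord_same, sweep_apply_of_le c ht, h1, flipCoord_same, Bool.not_not]
    · rw [flipCoord_of_ne h, sweep_apply_of_le c ht, h1, flipCoord_of_ne h]
  · intro y _
    simp [flipCoord_flipCoord]
  · intro j _
    simp [flipCoord_flipCoord]

theorem subcubeAt_eq_of_mem {s : ℕ} {x y : Cube d} (h : y ∈ subcubeAt s x) :
    subcubeAt s y = subcubeAt s x := by
  ext z
  rw [mem_subcubeAt] at h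
  rw [mem_subcubeAt, mem_subcubeAt]
  exact forall₂_congr fun t ht => by rw [h t ht]

/-- The sites whose coordinates from `s` on vanish. -/
def lowSites (d s : ℕ) : Finset (Cube d) := subcubeAt s fun _ => false

theorem sum_subcubeAt_partner (c : Coins d) {s : Fin d} {x : Cube d}
    (hx : flipCoord s x ∈ lowSites d s) (F : Cube d → ℝ) :
    coordMean s (fun y => F ((sweep c s)⁻¹ (flipCoord s y))) x
      = ((2 : ℝ) ^ (s : ℕ))⁻¹ * ∑ j ∈ lowSites d s, F j := by
  rw [coordMean_eq s.2.le, sum_partner, subcubeAt_eq_of_mem hx, lowSites]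

theorem apply_eq_true_of_flipCoord_mem {s : Fin d} {x : Cube d}
    (hx : flipCoord s x ∈ lowSites d s) : x s = true := by
  have := mem_subcubeAt.1 hx s le_rfl
  rw [flipCoord_same] at this
  simpa using this

theorem expect_sweepPartner {s : Fin d} {x : Cube d} (hx : flipCoord s x ∈ lowSites d s)
    (F : Cube d → ℝ) :
    𝔼 c : Coins d, F (sweepPartner c s x)
      = ((2 : ℝ) ^ (s : ℕ))⁻¹ * ∑ j ∈ lowSites d s, F j := by
  rw [expect_mixCoins s]
  simp_rw [sweepPartner_mixCoins _ _ (apply_eq_true_of_flipCoord_mem hx)]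
  have h1 : ∀ c' : Coins d, 𝔼 c : Coins d, F ((sweep c' s)⁻¹ (flipCoord s (sweep c s x)))
      = ((2 : ℝ) ^ (s : ℕ))⁻¹ * ∑ j ∈ lowSites d s, F j := fun c' => by
    rw [expect_sweep s.2.le (fun y => F ((sweep c' s)⁻¹ (flipCoord s y))),
      sum_subcubeAt_partner c' hx]
  simp_rw [h1]
  exact Fintype.expect_const _

theorem expect_prod_sqrt_sweepPartner_le {s : Fin d} {n : ℕ} {e : Fin n → Cube d}
    (he : Function.Injective e) (heL : ∀ t, flipCoord s (e t) ∈ lowSites d s)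
    {g : Fin n → Cube d → ℝ} (hg : ∀ t j, 0 ≤ g t j)
    (hg1 : ∀ t, ∑ j ∈ lowSites d s, g t j = 2 ^ (s : ℕ)) :
    𝔼 c : Coins d, ∏ t, √(g t (sweepPartner c s (e t))) ≤ 1 := by
  classical
  rw [expect_mixCoins s]
  simp_rw [sweepPartner_mixCoins _ _ (apply_eq_true_of_flipCoord_mem (heL _))]
  refine Finset.expect_le Finset.univ_nonempty fun c' _ => ?_
  set G : Cube d → Cube d → ℝ := Function.extend e
    (fun t y => g t ((sweep c' s)⁻¹ (flipCoord s y))) fun _ _ => 1 with hG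
  have hGe : ∀ t, G (e t) = fun y => g t ((sweep c' s)⁻¹ (flipCoord s y)) := fun t =>
    he.extend_apply _ _ _
  have hGn : ∀ x, (¬ ∃ t, e t = x) → G x = fun _ => 1 := fun x hx =>
    Function.extend_apply' _ _ _ hx
  have hG0 : ∀ x y, 0 ≤ G x y := by
    intro x y
    by_cases hx : ∃ t, e t = x
    · obtain ⟨t, rfl⟩ := hx
      rw [hGe]; exact hg _ _
    · rw [hGn x hx]; exact zero_le_one
  have hprod : ∀ F : Cube d → ℝ, (∀ x, (¬ ∃ t, e t = x) → F x = 1) →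
      ∏ x, F x = ∏ t, F (e t) := by
    intro F hF
    rw [← Finset.prod_image (s := Finset.univ) (g := e) (f := F) fun a _ b _ h => he h]
    refine (Finset.prod_subset (Finset.subset_univ _) fun x _ hx => hF x ?_).symm
    simpa using hx
  have h1 : ∀ c : Coins d, ∏ t, √(g t ((sweep c' s)⁻¹ (flipCoord s (sweep c s (e t)))))
      = ∏ x, √(G x (sweep c s x)) := fun c => by
    rw [hprod (fun x => √(G x (sweep c s x))) fun x hx => by rw [hGn x hx]; simp]
    exact Finset.prod_congr rfl fun t _ => by rw [hGe]
  simp_rw [h1]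
  refine (expect_prod_sqrt_sweep_le s.2.le hG0).trans (le_of_eq ?_)
  refine Finset.prod_eq_one fun x _ => ?_
  by_cases hx : ∃ t, e t = x
  · obtain ⟨t, rfl⟩ := hx
    rw [hGe, sum_subcubeAt_partner c' (heL t), hg1]
    simp
  · rw [hGn x hx, coordMean_eq s.2.le]
    simp [card_subcubeAt s.2.le]

/-- The permutations obtained by switches in direction `s` that are carried out after the sweep
through the directions before `s` has been performed and before it is undone. -/
def meetSub (c : Coins d) (s : Fin d) : Subgroup (Equiv.Perm (Cube d)) :=
  (switchSub s).comap (MulAut.conj (sweep c s)).toMonoidHom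

theorem swap_sweepPartner_mem (c : Coins d) (s : Fin d) (x : Cube d) :
    Equiv.swap x (sweepPartner c s x) ∈ meetSub c s := by
  rw [meetSub, Subgroup.mem_comap]
  simp only [MulEquiv.coe_toMonoidHom, MulAut.conj_apply]
  rw [Equiv.mul_swap_eq_swap_mul, mul_assoc, mul_inv_cancel, mul_one]
  have : sweep c s (sweepPartner c s x) = flipCoord s (sweep c s x) := by
    simp [sweepPartner]
  rw [this]
  exact swap_flipCoord_mem s _

theorem avgSub_meetSub (c : Coins d) (s : Fin d) (f : Equiv.Perm (Cube d) → ℝ)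
    (X : Equiv.Perm (Cube d)) :
    avgSub (meetSub c s) f X
      = avgSub (switchSub s) (fun Y => f ((sweep c s)⁻¹ * Y)) (sweep c s * X) := by
  classical
  let E : meetSub c s ≃ switchSub s :=
    { toFun := fun g => ⟨sweep c s * g.1 * (sweep c s)⁻¹, g.2⟩
      invFun := fun g => ⟨(sweep c s)⁻¹ * g.1 * sweep c s, by
        rw [meetSub, Subgroup.mem_comap]
        simp [mul_assoc, g.2]⟩
      left_inv := fun g => Subtype.ext (by simp [mul_assoc])
      right_inv := fun g => Subtype.ext (by simp [mul_assoc]) }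
  unfold avgSub
  rw [Fintype.card_congr E]
  refine Fintype.sum_equiv E _ _ fun g => ?_
  simp [E, mul_assoc]

theorem expect_eq_sum_inv_card_mul {ι : Type*} [Fintype ι] (F : ι → ℝ) :
    𝔼 i, F i = ∑ i, (Fintype.card ι : ℝ)⁻¹ * F i := by
  rw [Fintype.expect_eq_sum_div_card, ← Finset.mul_sum, div_eq_inv_mul]

/-- Entropy of one generation of sites against the entropy lost in one direction of a sweep. -/
theorem entropy_lowSites_le (s : Fin d) {h : Coins d → Equiv.Perm (Cube d) → ℝ}
    (hh : ∀ c X, 0 < h c X) {nu : Equiv.Perm (Cube d) → ℝ}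
    (hnu : ∀ X, nu X = 𝔼 c, h c X) :
    ∑ X, nu X * Real.log (avgSub (permsOn (lowSites d s)) nu X /
        avgSub (permsOn (lowSites d (s + 1))) nu X)
      ≤ 432 * d * (∑ X, 𝔼 c, h c X * Real.log (h c X / nu X)
        + 𝔼 c, (∑ X, xlogx (h c X) - ∑ X, xlogx (avgSub (meetSub c s) (h c) X))) := by
  classical
  have hcard : (lowSites d s).card = 2 ^ (s : ℕ) := card_subcubeAt s.2.le _
  set φ := (lowSites d s).equivFinOfCardEq hcard
  set e : Fin (2 ^ (s : ℕ)) → Cube d := fun t => flipCoord s (φ.symm t).1 with he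
  have hei : Function.Injective e := fun a b h =>
    φ.symm.injective (Subtype.ext (flipCoord_injective s h))
  have heL : ∀ t, flipCoord s (e t) ∈ lowSites d s := fun t => by
    rw [he, flipCoord_flipCoord]; exact (φ.symm t).2
  have hd : ∀ t, e t ∉ lowSites d s := fun t ht => by
    have h1 := mem_subcubeAt.1 ht s le_rfl
    rw [apply_eq_true_of_flipCoord_mem (heL t)] at h1
    simp at h1
  have hchain : siteChain (lowSites d s) e (2 ^ (s : ℕ)) = lowSites d (s + 1) := by
    have h1 := subcubeAt_succ s fun _ => false
    rw [← lowSites, ← lowSites] at h1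
    rw [h1]
    ext x
    rw [mem_siteChain, Finset.mem_union, Finset.mem_image]
    refine or_congr Iff.rfl ⟨?_, ?_⟩
    · rintro ⟨a, -, rfl⟩
      exact ⟨(φ.symm a).1, (φ.symm a).2, rfl⟩
    · rintro ⟨y, hy, rfl⟩
      exact ⟨φ ⟨y, hy⟩, (φ ⟨y, hy⟩).2, by simp [he]⟩
  have hnu0 : ∀ X, 0 < nu X := fun X => by
    rw [hnu]; exact Finset.expect_pos (fun c _ => hh c X) Finset.univ_nonempty
  have hpartner : ∀ (c : Coins d) t, sweepPartner c s (e t) ∈ lowSites d s := fun c t => by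
    rw [lowSites, mem_subcubeAt]
    intro u hu
    unfold sweepPartner
    rw [sweep_inv_apply_of_le c hu]
    have h1 := mem_subcubeAt.1 (heL t) u hu
    by_cases hus : u = s
    · subst hus
      rw [flipCoord_same] at h1 ⊢
      rwa [sweep_apply_of_le c le_rfl]
    · rw [flipCoord_of_ne hus] at h1 ⊢
      rwa [sweep_apply_of_le c hu]
  have key := entropy_le_of_random_matching (C := Coins d) (L := lowSites d s) (e := e)
    (w := fun _ => (Fintype.card (Coins d) : ℝ)⁻¹) (m := fun c t => sweepPartner c s (e t))
    (K := fun c => meetSub c s) (h := h) (nu := nu) (D := d)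
    (fun _ => by positivity) hei hd hcard hpartner
    (fun c a b hab => hei (sweepPartner_injective c s hab))
    (fun t F => by
      have := expect_sweepPartner (heL t) F
      rw [expect_eq_sum_inv_card_mul] at this
      rw [this]; push_cast; rfl)
    (fun g hg hg1 => by
      have := expect_prod_sqrt_sweepPartner_le hei heL hg
        fun t => by rw [hg1]; push_cast; rfl
      rwa [expect_eq_sum_inv_card_mul] at this)
    (fun c t => swap_sweepPartner_mem c s (e t)) hh
    (fun X => by rw [hnu, expect_eq_sum_inv_card_mul]) hnu0
    (by have := s.2; omega)
    (by
      rw [← pow_succ']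
      exact Nat.pow_le_pow_right (by norm_num) s.2)
  rw [hchain] at key
  simpa only [expect_eq_sum_inv_card_mul] using key

end SweepMatching

/-! ### Entropy and the `L²` norm along the zigzag -/

section Zigzag

open scoped BigOperators

variable {d : ℕ}

/-- The averaging operators in the directions of a list, the last direction acting first. -/
noncomputable def opList (l : List (Fin d)) (f : Equiv.Perm (Cube d) → ℝ) :
    Equiv.Perm (Cube d) → ℝ :=
  l.foldr (fun j F => avgSub (switchSub j) F) f

theorem opList_nil (f : Equiv.Perm (Cube d) → ℝ) : opList [] f = f := rfl

theorem opList_cons (j : Fin d) (l : List (Fin d)) (f : Equiv.Perm (Cube d) → ℝ) :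
    opList (j :: l) f = avgSub (switchSub j) (opList l f) := rfl

theorem opList_append (l l' : List (Fin d)) (f : Equiv.Perm (Cube d) → ℝ) :
    opList (l ++ l') f = opList l (opList l' f) := by
  simp [opList, List.foldr_append]

theorem opList_pos (l : List (Fin d)) {f : Equiv.Perm (Cube d) → ℝ} (hf : ∀ X, 0 < f X)
    (X : Equiv.Perm (Cube d)) : 0 < opList l f X := by
  induction l generalizing X with
  | nil => exact hf X
  | cons j l ih => exact avgSub_pos _ ih X

theorem opList_mono (l : List (Fin d)) {f f' : Equiv.Perm (Cube d) → ℝ}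
    (hf : ∀ X, f X ≤ f' X) (X : Equiv.Perm (Cube d)) : opList l f X ≤ opList l f' X := by
  induction l generalizing X with
  | nil => exact hf X
  | cons j l ih => exact avgSub_mono _ ih X

theorem opList_const (l : List (Fin d)) (a : ℝ) :
    opList l (fun _ => a) = fun _ => a := by
  induction l with
  | nil => rfl
  | cons j l ih => rw [opList_cons, ih]; funext X; exact avgSub_const _ _ _

theorem opList_add (l : List (Fin d)) (f f' : Equiv.Perm (Cube d) → ℝ) :
    opList l (fun X => f X + f' X) = fun X => opList l f X + opList l f' X := by
  induction l with
  | nil => rfl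
  | cons j l ih => rw [opList_cons, ih]; funext X; exact avgSub_add _ _ _ _

theorem opList_const_mul (l : List (Fin d)) (a : ℝ) (f : Equiv.Perm (Cube d) → ℝ) :
    opList l (fun X => a * f X) = fun X => a * opList l f X := by
  induction l with
  | nil => rfl
  | cons j l ih => rw [opList_cons, ih]; funext X; exact avgSub_const_mul _ _ _ _

theorem sum_opList_mul (l : List (Fin d)) (f f' : Equiv.Perm (Cube d) → ℝ) :
    ∑ X, opList l f X * f' X = ∑ X, f X * opList l.reverse f' X := by
  induction l generalizing f' with
  | nil => rfl
  | cons j l ih =>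
    rw [List.reverse_cons, opList_append, ← ih, opList_cons, sum_avgSub_mul]
    rfl

theorem sum_opList (l : List (Fin d)) (f : Equiv.Perm (Cube d) → ℝ) :
    ∑ X, opList l f X = ∑ X, f X := by
  have := sum_opList_mul l f fun _ => 1
  simpa [opList_const] using this

theorem xlogx_opList_le (l : List (Fin d)) {f : Equiv.Perm (Cube d) → ℝ} (hf : ∀ X, 0 < f X)
    (X : Equiv.Perm (Cube d)) :
    xlogx (opList l f X) ≤ opList l (fun Y => xlogx (f Y)) X := by
  induction l generalizing X with
  | nil => exact le_rfl
  | cons j l ih =>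
    exact (xlogx_avgSub_le _ (fun Y => (opList_pos l hf Y).le) X).trans (avgSub_mono _ ih X)

theorem sum_sq_avgSub_le {G : Type*} [Group G] [Fintype G] (H : Subgroup G) (f : G → ℝ) :
    ∑ X, avgSub H f X ^ 2 ≤ ∑ X, f X ^ 2 := by
  have h1 : ∑ X, avgSub H f X ^ 2 = ∑ X, f X * avgSub H f X := by
    simp_rw [sq]
    rw [sum_avgSub_mul]
    exact Finset.sum_congr rfl fun X _ => by rw [avgSub_avgSub_of_le le_rfl]
  have h2 : 0 ≤ ∑ X, (f X - avgSub H f X) ^ 2 := Finset.sum_nonneg fun _ _ => sq_nonneg _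
  have h3 : ∑ X, (f X - avgSub H f X) ^ 2
      = ∑ X, f X ^ 2 - 2 * ∑ X, f X * avgSub H f X + ∑ X, avgSub H f X ^ 2 := by
    rw [Finset.mul_sum, ← Finset.sum_sub_distrib, ← Finset.sum_add_distrib]
    exact Finset.sum_congr rfl fun _ _ => by ring
  linarith

theorem sum_sq_opList_le (l : List (Fin d)) (f : Equiv.Perm (Cube d) → ℝ) :
    ∑ X, opList l f X ^ 2 ≤ ∑ X, f X ^ 2 := by
  induction l with
  | nil => exact le_rfl
  | cons j l ih => exact (sum_sq_avgSub_le _ _).trans ih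

theorem sum_sq_opList_reverse (l : List (Fin d)) (f : Equiv.Perm (Cube d) → ℝ) :
    ∑ X, opList l.reverse f X ^ 2 = ∑ X, f X * opList l (opList l.reverse f) X := by
  simp_rw [sq]
  rw [sum_opList_mul, List.reverse_reverse]

theorem sum_sq_opList_palindrome_le (l : List (Fin d)) (f : Equiv.Perm (Cube d) → ℝ) :
    ∑ X, opList l (opList l.reverse f) X ^ 2 ≤ ∑ X, f X * opList l (opList l.reverse f) X :=
  (sum_sq_opList_le _ _).trans (sum_sq_opList_reverse l f).le

/-- The transition operator of one period of the zigzag shuffle. -/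
noncomputable def zigzagOp (f : Equiv.Perm (Cube d) → ℝ) : Equiv.Perm (Cube d) → ℝ :=
  opList (List.finRange d ++ (List.finRange d).reverse) f

theorem zigzagOp_eq (f : Equiv.Perm (Cube d) → ℝ) :
    zigzagOp f = opList (List.finRange d) (opList (List.finRange d).reverse f) :=
  opList_append _ _ _

theorem sum_zigzagOp_mul (f f' : Equiv.Perm (Cube d) → ℝ) :
    ∑ X, zigzagOp f X * f' X = ∑ X, f X * zigzagOp f' X := by
  unfold zigzagOp
  rw [sum_opList_mul, List.reverse_append, List.reverse_reverse]

theorem take_finRange_succ (s : Fin d) :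
    (List.finRange d).take (s + 1) = (List.finRange d).take s ++ [s] := by
  rw [List.take_add_one]
  simp

theorem drop_finRange (s : Fin d) :
    (List.finRange d).drop s = s :: (List.finRange d).drop (s + 1) := by
  rw [List.drop_eq_getElem_cons (by simp)]
  simp

theorem sweep_update (c : Coins d) (s : Fin d) (κ : DirEdge s → Bool) :
    sweep (Function.update c s κ) (s + 1) = switchEdges s κ * sweep c s := by
  rw [sweep_succ, Function.update_self]
  congr 1
  exact sweep_congr fun t ht => Function.update_of_ne (fun h => by rw [h] at ht; simp at ht) _ _

theorem opList_take {s : ℕ} (hs : s ≤ d) (f : Equiv.Perm (Cube d) → ℝ)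
    (X : Equiv.Perm (Cube d)) :
    opList ((List.finRange d).take s) f X = 𝔼 c : Coins d, f (sweep c s * X) := by
  induction s generalizing f with
  | zero => simp [sweep, opList_nil]
  | succ s ih =>
    have h1 := take_finRange_succ ⟨s, hs⟩
    simp only at h1
    rw [h1, opList_append, ih (by omega),
      expect_update (⟨s, hs⟩ : Fin d) fun c : Coins d => f (sweep c (s + 1) * X)]
    refine Finset.expect_congr rfl fun c _ => ?_
    rw [opList_cons, opList_nil, ← expect_switchEdges]
    refine Finset.expect_congr rfl fun κ _ => ?_
    have h2 := sweep_update c ⟨s, hs⟩ κ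
    simp only at h2
    rw [h2, mul_assoc]

theorem opList_take_reverse {s : ℕ} (hs : s ≤ d) (f : Equiv.Perm (Cube d) → ℝ)
    (X : Equiv.Perm (Cube d)) :
    opList ((List.finRange d).take s).reverse f X = 𝔼 c : Coins d, f ((sweep c s)⁻¹ * X) := by
  induction s generalizing X with
  | zero => simp [sweep, opList_nil]
  | succ s ih =>
    have h1 := take_finRange_succ ⟨s, hs⟩
    simp only at h1
    rw [h1, List.reverse_append, List.reverse_singleton, List.singleton_append, opList_cons,
      ← expect_switchEdges, expect_update (⟨s, hs⟩ : Fin d), Finset.expect_comm]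
    refine Finset.expect_congr rfl fun κ _ => ?_
    rw [ih (by omega)]
    refine Finset.expect_congr rfl fun c _ => ?_
    have h2 := sweep_update c ⟨s, hs⟩ κ
    simp only at h2
    rw [h2, mul_inv_rev, switchEdges_inv, mul_assoc]

/-- The part of the zigzag that follows the sweep through the directions before `s`. -/
noncomputable def zigzagTail (s : ℕ) (f : Equiv.Perm (Cube d) → ℝ) : Equiv.Perm (Cube d) → ℝ :=
  opList ((List.finRange d).drop s ++ (List.finRange d).reverse) f

theorem zigzagOp_eq_take (s : ℕ) (f : Equiv.Perm (Cube d) → ℝ) :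
    zigzagOp f = opList ((List.finRange d).take s) (zigzagTail s f) := by
  rw [zigzagTail, ← opList_append, ← List.append_assoc, List.take_append_drop]
  rfl

theorem zigzagOp_eq_expect {s : ℕ} (hs : s ≤ d) (f : Equiv.Perm (Cube d) → ℝ)
    (X : Equiv.Perm (Cube d)) :
    zigzagOp f X = 𝔼 c : Coins d, zigzagTail s f (sweep c s * X) := by
  rw [zigzagOp_eq_take s, opList_take hs]

theorem zigzagTail_mul (s : Fin d) {k : Equiv.Perm (Cube d)} (hk : k ∈ switchSub s)
    (f : Equiv.Perm (Cube d) → ℝ) (X : Equiv.Perm (Cube d)) :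
    zigzagTail s f (k * X) = zigzagTail s f X := by
  rw [zigzagTail, drop_finRange, List.cons_append, opList_cons, avgSub_apply_mul _ hk]

/-- The entropy dissipated in one period. -/
noncomputable def dissipation (f : Equiv.Perm (Cube d) → ℝ) : ℝ :=
  ∑ X, (zigzagOp f X * xlogx (f X) - f X * xlogx (zigzagOp f X))

theorem coin_information_le_dissipation {s : ℕ} (hs : s ≤ d)
    {f : Equiv.Perm (Cube d) → ℝ} (hf : ∀ X, 0 < f X) :
    ∑ X, 𝔼 c : Coins d, f X * zigzagTail s f (sweep c s * X) *
        Real.log (f X * zigzagTail s f (sweep c s * X) / (f X * zigzagOp f X))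
      ≤ dissipation f := by
  have hG : ∀ X, 0 < zigzagTail s f X := fun X => opList_pos _ hf X
  have hZ : ∀ X, 0 < zigzagOp f X := fun X => opList_pos _ hf X
  have h1 : ∀ X, 𝔼 c : Coins d, f X * zigzagTail s f (sweep c s * X) *
        Real.log (f X * zigzagTail s f (sweep c s * X) / (f X * zigzagOp f X))
      = f X * (opList ((List.finRange d).take s) (fun Y => xlogx (zigzagTail s f Y)) X
        - xlogx (zigzagOp f X)) := by
    intro X
    have h2 : ∀ c : Coins d, f X * zigzagTail s f (sweep c s * X) *
        Real.log (f X * zigzagTail s f (sweep c s * X) / (f X * zigzagOp f X))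
        = f X * (xlogx (zigzagTail s f (sweep c s * X))
          - zigzagTail s f (sweep c s * X) * Real.log (zigzagOp f X)) := by
      intro c
      rw [mul_div_mul_left _ _ (hf X).ne', Real.log_div (hG _).ne' (hZ X).ne', xlogx]
      ring
    rw [Finset.expect_congr rfl fun c _ => h2 c, ← Finset.mul_expect, Finset.expect_sub_distrib,
      ← Finset.expect_mul, ← zigzagOp_eq_expect hs, opList_take hs]
    rfl
  have h3 : ∀ X, opList ((List.finRange d).take s) (fun Y => xlogx (zigzagTail s f Y)) X
      ≤ zigzagOp (fun Y => xlogx (f Y)) X := by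
    intro X
    rw [zigzagOp_eq_take s]
    exact opList_mono _ (fun Y => xlogx_opList_le _ hf Y) X
  rw [Finset.sum_congr rfl fun X _ => h1 X, dissipation, Finset.sum_sub_distrib,
    sum_zigzagOp_mul, ← Finset.sum_sub_distrib]
  refine Finset.sum_le_sum fun X _ => ?_
  rw [← mul_sub]
  exact mul_le_mul_of_nonneg_left (by linarith [h3 X]) (hf X).le

theorem zigzagTail_gibbs (s : Fin d) {f : Equiv.Perm (Cube d) → ℝ} (hf : ∀ X, 0 < f X) :
    ∑ X, f X * xlogx (zigzagOp f X)
      ≤ ∑ X, zigzagTail s f X *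
        xlogx (opList ((List.finRange d).take (s + 1)).reverse f X) := by
  set G := zigzagTail s f with hG
  set l := (List.finRange d).take (s + 1) with hl
  set F := opList l.reverse f with hF
  have hGpos : ∀ X, 0 < G X := fun X => opList_pos _ hf X
  have hFpos : ∀ X, 0 < F X := fun X => opList_pos _ hf X
  have hFs : avgSub (switchSub s) F = F := by
    funext X
    refine avgSub_of_invariant _ (fun k hk Y => ?_) X
    rw [hF, hl, take_finRange_succ, List.reverse_append, List.reverse_singleton,
      List.singleton_append, opList_cons, avgSub_apply_mul _ hk]
  have hGs : avgSub (switchSub s) G = G := by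
    funext X
    exact avgSub_of_invariant _ (fun k hk Y => zigzagTail_mul s hk f Y) X
  have hZ : zigzagOp f = opList l G := by
    rw [zigzagOp_eq_take s, hl, take_finRange_succ, opList_append, opList_cons, opList_nil,
      ← hG, hGs]
  have hGF : G = opList ((List.finRange d).drop s)
      (opList ((List.finRange d).drop s).reverse F) := by
    have h1 : (List.finRange d).reverse
        = ((List.finRange d).drop (s + 1)).reverse ++ l.reverse := by
      rw [← List.reverse_append, hl, List.take_append_drop]
    rw [hG, zigzagTail, h1, opList_append, opList_append, ← hF]
    congr 1
    rw [drop_finRange s, List.reverse_cons, opList_append, opList_cons, opList_nil, hFs]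
  have h1 : ∑ X, G X ^ 2 ≤ ∑ X, F X * G X := by
    have := sum_sq_opList_palindrome_le ((List.finRange d).drop s) F
    rwa [← hGF] at this
  have h2 : ∑ X, F X * xlogx (G X) ≤ ∑ X, G X * xlogx (F X) := by
    have h3 : ∀ X, F X * xlogx (G X) - G X * xlogx (F X) ≤ G X ^ 2 - F X * G X := by
      intro X
      have h4 : Real.log (G X / F X) ≤ G X / F X - 1 :=
        Real.log_le_sub_one_of_pos (div_pos (hGpos X) (hFpos X))
      rw [Real.log_div (hGpos X).ne' (hFpos X).ne'] at h4
      have h5 := mul_le_mul_of_nonneg_left h4 (mul_pos (hFpos X) (hGpos X)).le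
      have h6 : F X * G X * (G X / F X - 1) = G X ^ 2 - F X * G X := by
        have := (hFpos X).ne'
        field_simp
      rw [h6] at h5
      unfold xlogx
      linarith
    have h7 := Finset.sum_le_sum fun X (_ : X ∈ Finset.univ) => h3 X
    rw [Finset.sum_sub_distrib, Finset.sum_sub_distrib] at h7
    linarith
  refine le_trans ?_ h2
  have h3 := sum_opList_mul l.reverse f fun X => xlogx (G X)
  rw [List.reverse_reverse] at h3
  rw [hF, h3]
  refine Finset.sum_le_sum fun X _ => mul_le_mul_of_nonneg_left ?_ (hf X).le
  rw [hZ]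
  exact xlogx_opList_le l hGpos X

theorem xlogx_expect_le {ι : Type*} [Fintype ι] [Nonempty ι] {a : ι → ℝ} (ha : ∀ i, 0 ≤ a i) :
    xlogx (𝔼 i, a i) ≤ 𝔼 i, xlogx (a i) := by
  rw [expect_eq_sum_inv_card_mul, expect_eq_sum_inv_card_mul]
  refine xlogx_sum_le _ (fun _ => by positivity) ?_ ha
  simp

end Zigzag

section Contraction

open scoped BigOperators

variable {d : ℕ}

theorem xlogx_mul {a b : ℝ} (ha : 0 < a) (hb : 0 < b) :
    xlogx (a * b) = xlogx a * b + a * xlogx b := by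
  unfold xlogx
  rw [Real.log_mul ha.ne' hb.ne']
  ring

/-- Multiplying by an invariant function does not change the relative entropy loss. -/
theorem entropy_loss_mul {G : Type*} [Group G] [Fintype G] (H : Subgroup G) {f g : G → ℝ}
    (hf : ∀ X, 0 < f X) (hg : ∀ X, 0 < g X) (hgH : ∀ k ∈ H, ∀ X, g (k * X) = g X) :
    ∑ X, xlogx (f X * g X) - ∑ X, xlogx (avgSub H (fun Y => f Y * g Y) X)
      = ∑ X, g X * xlogx (f X) - ∑ X, g X * xlogx (avgSub H f X) := by
  have h1 : ∀ X, xlogx (avgSub H (fun Y => f Y * g Y) X)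
      = xlogx (avgSub H f X) * g X + avgSub H f X * xlogx (g X) := fun X => by
    rw [avgSub_mul_of_invariant H hgH, xlogx_mul (avgSub_pos H hf X) (hg X)]
  have h2 : ∑ X, avgSub H f X * xlogx (g X) = ∑ X, f X * xlogx (g X) := by
    rw [sum_avgSub_mul]
    refine Finset.sum_congr rfl fun X _ => ?_
    rw [avgSub_of_invariant]
    intro k hk Y
    rw [hgH k hk]
  simp_rw [h1, xlogx_mul (hf _) (hg _)]
  rw [Finset.sum_add_distrib, Finset.sum_add_distrib, h2]
  have h3 : ∀ u : G → ℝ, ∑ X, u X * g X = ∑ X, g X * u X := fun u =>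
    Finset.sum_congr rfl fun _ _ => mul_comm _ _
  rw [h3 fun X => xlogx (f X), h3 fun X => xlogx (avgSub H f X)]
  ring

theorem matching_loss_le_dissipation (s : Fin d) {f : Equiv.Perm (Cube d) → ℝ}
    (hf : ∀ X, 0 < f X) :
    𝔼 c : Coins d, (∑ X, xlogx (f X * zigzagTail s f (sweep c s * X))
      - ∑ X, xlogx (avgSub (meetSub c s)
          (fun Y => f Y * zigzagTail s f (sweep c s * Y)) X)) ≤ dissipation f := by
  set G := zigzagTail s f with hG
  have hGpos : ∀ X, 0 < G X := fun X => opList_pos _ hf X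
  have h1 : ∀ c : Coins d, (∑ X, xlogx (f X * G (sweep c s * X))
      - ∑ X, xlogx (avgSub (meetSub c s) (fun Y => f Y * G (sweep c s * Y)) X))
      = ∑ X, G (sweep c s * X) * xlogx (f X) - ∑ W, G W *
        xlogx (avgSub (switchSub s) (fun Y => f ((sweep c s)⁻¹ * Y)) W) := by
    intro c
    rw [entropy_loss_mul (meetSub c s) (g := fun Y => G (sweep c s * Y)) hf fun X => hGpos _]
    · congr 1
      refine Fintype.sum_equiv (Equiv.mulLeft (sweep c s)) _ _ fun X => ?_
      rw [avgSub_meetSub]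
      rfl
    · intro k hk X
      have h2 : sweep c s * (k * X) = sweep c s * k * (sweep c s)⁻¹ * (sweep c s * X) := by
        group
      rw [h2]
      exact zigzagTail_mul s hk f _
  rw [Finset.expect_congr rfl fun c _ => h1 c, Finset.expect_sub_distrib]
  have h2 : 𝔼 c : Coins d, ∑ X, G (sweep c s * X) * xlogx (f X)
      = ∑ X, zigzagOp f X * xlogx (f X) := by
    rw [Finset.expect_sum_comm]
    refine Finset.sum_congr rfl fun X _ => ?_
    rw [← Finset.expect_mul, ← zigzagOp_eq_expect s.2.le]
  have h3 : ∑ X, G X * xlogx (opList ((List.finRange d).take (s + 1)).reverse f X)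
      ≤ 𝔼 c : Coins d, ∑ W, G W *
        xlogx (avgSub (switchSub s) (fun Y => f ((sweep c s)⁻¹ * Y)) W) := by
    rw [Finset.expect_sum_comm]
    refine Finset.sum_le_sum fun W _ => ?_
    rw [← Finset.mul_expect]
    refine mul_le_mul_of_nonneg_left ?_ (hGpos W).le
    refine le_trans (le_of_eq ?_)
      (xlogx_expect_le fun c => avgSub_nonneg _ (fun Y => (hf _).le) W)
    congr 1
    rw [take_finRange_succ, List.reverse_append, List.reverse_singleton,
      List.singleton_append, opList_cons]
    have h4 : opList ((List.finRange d).take s).reverse f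
        = fun X => ∑ c : Coins d, (Fintype.card (Coins d) : ℝ)⁻¹ * f ((sweep c s)⁻¹ * X) := by
      funext X
      rw [opList_take_reverse s.2.le, expect_eq_sum_inv_card_mul]
    rw [h4, avgSub_sum _ Finset.univ (fun _ => _) fun (c : Coins d) Y => f ((sweep c s)⁻¹ * Y),
      expect_eq_sum_inv_card_mul]
  have h4 := zigzagTail_gibbs s hf
  rw [h2, dissipation, Finset.sum_sub_distrib]
  linarith

theorem avgSub_permsOn_lowSites_zero (f : Equiv.Perm (Cube d) → ℝ) (X : Equiv.Perm (Cube d)) :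
    avgSub (permsOn (lowSites d 0)) f X = f X := by
  refine avgSub_of_invariant _ (fun k hk Y => ?_) X
  have h1 : k = 1 := by
    have h2 : ∀ x, x ≠ (fun _ => false) → k x = x := fun x hx => hk x fun hx' =>
      hx (funext fun t => mem_subcubeAt.1 hx' t (Nat.zero_le _))
    ext1 x
    by_cases hx : x = fun _ => false
    · by_contra hne
      rw [Equiv.Perm.one_apply] at hne
      have h3 : k x ≠ fun _ => false := fun h => hne (h.trans hx.symm)
      exact hne (k.injective (h2 _ h3))
    · exact h2 x hx
  rw [h1, one_mul]

theorem avgSub_permsOn_lowSites_top (f : Equiv.Perm (Cube d) → ℝ) (X : Equiv.Perm (Cube d)) :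
    avgSub (permsOn (lowSites d d)) f X
      = (∑ Y, f Y) / Fintype.card (Equiv.Perm (Cube d)) := by
  have hmem : ∀ k : Equiv.Perm (Cube d), k ∈ permsOn (lowSites d d) := fun k x hx =>
    absurd (mem_subcubeAt.2 fun t ht => absurd t.2 (by omega)) hx
  have h1 : ∀ Y, avgSub (permsOn (lowSites d d)) f Y = avgSub (permsOn (lowSites d d)) f X := by
    intro Y
    have := avgSub_apply_mul (permsOn (lowSites d d)) (hmem (Y * X⁻¹)) f X
    rwa [inv_mul_cancel_right] at this
  rw [← sum_avgSub (permsOn (lowSites d d)) f, Finset.sum_congr rfl fun Y _ => h1 Y,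
    Finset.sum_const, Finset.card_univ, nsmul_eq_mul, mul_div_cancel_left₀]
  exact_mod_cast Fintype.card_ne_zero

/-- The entropy of `f * zigzagOp f` is controlled by the dissipation. -/
theorem entropy_le_dissipation {f : Equiv.Perm (Cube d) → ℝ} (hf : ∀ X, 0 < f X) :
    ∑ X, f X * zigzagOp f X * Real.log (f X * zigzagOp f X /
        ((∑ Y, f Y * zigzagOp f Y) / Fintype.card (Equiv.Perm (Cube d))))
      ≤ 864 * (d : ℝ) ^ 2 * dissipation f := by
  have hZ : ∀ X, 0 < zigzagOp f X := fun X => opList_pos _ hf X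
  set nu : Equiv.Perm (Cube d) → ℝ := fun X => f X * zigzagOp f X with hnu
  have hnu0 : ∀ X, 0 < nu X := fun X => mul_pos (hf X) (hZ X)
  set A : ℕ → Equiv.Perm (Cube d) → ℝ := fun s => avgSub (permsOn (lowSites d s)) nu with hA
  have hApos : ∀ s X, 0 < A s X := fun s X => avgSub_pos _ hnu0 X
  have hstep : ∀ s : Fin d, ∑ X, nu X * Real.log (A s X / A (s + 1) X)
      ≤ 864 * d * dissipation f := by
    intro s
    have h1 := entropy_lowSites_le s
      (h := fun c X => f X * zigzagTail s f (sweep c s * X)) (nu := nu)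
      (fun c X => mul_pos (hf X) (opList_pos _ hf _))
      (fun X => by rw [hnu, ← Finset.mul_expect, ← zigzagOp_eq_expect s.2.le])
    refine h1.trans ?_
    have h2 := coin_information_le_dissipation s.2.le hf
    have h3 := matching_loss_le_dissipation s hf
    have hd : (0 : ℝ) ≤ 432 * d := by positivity
    calc _ ≤ 432 * d * (dissipation f + dissipation f) :=
          mul_le_mul_of_nonneg_left (add_le_add h2 h3) hd
      _ = _ := by ring
  have htel : ∀ X, nu X * Real.log (nu X / ((∑ Y, f Y * zigzagOp f Y) /
      Fintype.card (Equiv.Perm (Cube d))))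
      = ∑ s : Fin d, nu X * Real.log (A s X / A (s + 1) X) := by
    intro X
    rw [← Finset.mul_sum, Fin.sum_univ_eq_sum_range (fun t => Real.log (A t X / A (t + 1) X))]
    have h1 : ∀ t ∈ Finset.range d, Real.log (A t X / A (t + 1) X)
        = Real.log (A t X) - Real.log (A (t + 1) X) := fun t _ =>
      Real.log_div (hApos _ _).ne' (hApos _ _).ne'
    rw [Finset.sum_congr rfl h1, Finset.sum_range_sub',
      ← Real.log_div (hApos _ _).ne' (hApos _ _).ne']
    simp only [hA, avgSub_permsOn_lowSites_zero, avgSub_permsOn_lowSites_top]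
    rfl
  rw [Finset.sum_congr rfl fun X _ => htel X, Finset.sum_comm]
  refine (Finset.sum_le_sum fun s _ => hstep s).trans (le_of_eq ?_)
  rw [Finset.sum_const, Finset.card_univ, Fintype.card_fin, nsmul_eq_mul]
  ring

/-- One period of the zigzag contracts the logarithm of the `L²` norm of a density. -/
theorem log_sum_sq_zigzagOp_le (hd : 1 ≤ d) {f : Equiv.Perm (Cube d) → ℝ} (hf : ∀ X, 0 < f X)
    (hf1 : ∑ X, f X = Fintype.card (Equiv.Perm (Cube d))) :
    Real.log ((∑ X, zigzagOp f X ^ 2) / Fintype.card (Equiv.Perm (Cube d)))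
      ≤ (1 - 1 / (864 * (d : ℝ) ^ 2)) *
        Real.log ((∑ X, f X ^ 2) / Fintype.card (Equiv.Perm (Cube d))) := by
  have hZ : ∀ X, 0 < zigzagOp f X := fun X => opList_pos _ hf X
  set N : ℝ := (Fintype.card (Equiv.Perm (Cube d)) : ℝ) with hN
  have hN0 : 0 < N := by rw [hN]; exact_mod_cast Fintype.card_pos
  set S : ℝ := ∑ X, f X * zigzagOp f X with hS
  have hS0 : 0 < S := Finset.sum_pos (fun X _ => mul_pos (hf X) (hZ X)) Finset.univ_nonempty
  set Q : ℝ := (∑ X, f X ^ 2) / N with hQ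
  have hQ0 : 0 < Q :=
    div_pos (Finset.sum_pos (fun X _ => pow_pos (hf X) 2) Finset.univ_nonempty) hN0
  have hB0 : 0 < S / N := div_pos hS0 hN0
  have hent := entropy_le_dissipation hf
  rw [← hS, ← hN] at hent
  set D' : ℝ := ∑ X, f X * zigzagOp f X * Real.log (f X * zigzagOp f X / (S / N)) with hD'
  set a : ℝ := ∑ X, f X * zigzagOp f X * Real.log (f X) with ha
  set b : ℝ := ∑ X, f X * zigzagOp f X * Real.log (zigzagOp f X) with hb
  have hdis : dissipation f = a - b := by
    rw [dissipation, ha, hb, ← Finset.sum_sub_distrib]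
    exact Finset.sum_congr rfl fun X _ => by unfold xlogx; ring
  have hD'eq : D' = a + b - S * Real.log (S / N) := by
    rw [hD', ha, hb, hS, Finset.sum_mul, ← Finset.sum_add_distrib, ← Finset.sum_sub_distrib]
    refine Finset.sum_congr rfl fun X _ => ?_
    rw [Real.log_div (mul_pos (hf X) (hZ X)).ne' hB0.ne',
      Real.log_mul (hf X).ne' (hZ X).ne']
    ring
  have hg1 : 2 * a ≤ D' + S * Real.log Q := by
    have h1 : ∀ X, f X * zigzagOp f X - f X ^ 2 * (S / N) / Q
        ≤ f X * zigzagOp f X * (Real.log (zigzagOp f X) - Real.log (f X)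
          - Real.log (S / N) + Real.log Q) := by
      intro X
      have h2 := log_sub_add_nonneg (mul_pos (hf X) (hZ X))
        (div_pos (mul_pos (pow_pos (hf X) 2) hB0) hQ0)
      rw [Real.log_div (mul_pos (hf X) (hZ X)).ne'
        (div_pos (mul_pos (pow_pos (hf X) 2) hB0) hQ0).ne',
        Real.log_mul (hf X).ne' (hZ X).ne', Real.log_div
        (mul_pos (pow_pos (hf X) 2) hB0).ne' hQ0.ne', Real.log_mul (pow_pos (hf X) 2).ne' hB0.ne',
        Real.log_pow] at h2
      refine h2.trans (le_of_eq ?_)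
      push_cast; ring
    have h2 := Finset.sum_le_sum fun X (_ : X ∈ Finset.univ) => h1 X
    have h3 : ∑ X, (f X * zigzagOp f X - f X ^ 2 * (S / N) / Q) = 0 := by
      rw [Finset.sum_sub_distrib, ← hS, ← Finset.sum_div, ← Finset.sum_mul]
      have h4 : ∑ X, f X ^ 2 = Q * N := by rw [hQ]; field_simp
      rw [h4]; field_simp; ring
    have h4 : ∑ X, f X * zigzagOp f X * (Real.log (zigzagOp f X) - Real.log (f X)
          - Real.log (S / N) + Real.log Q) = b - a - S * Real.log (S / N) + S * Real.log Q := by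
      rw [ha, hb, hS, Finset.sum_mul, Finset.sum_mul, ← Finset.sum_sub_distrib,
        ← Finset.sum_sub_distrib, ← Finset.sum_add_distrib]
      exact Finset.sum_congr rfl fun X _ => by ring
    rw [h3, h4] at h2
    linarith
  have hg2 : a ≤ D' := by
    have h1 : ∀ X, f X * zigzagOp f X - f X * (S / N)
        ≤ f X * zigzagOp f X * (Real.log (zigzagOp f X) - Real.log (S / N)) := by
      intro X
      have h2 := log_sub_add_nonneg (mul_pos (hf X) (hZ X)) (mul_pos (hf X) hB0)
      rwa [mul_div_mul_left _ _ (hf X).ne', Real.log_div (hZ X).ne' hB0.ne'] at h2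
    have h2 := Finset.sum_le_sum fun X (_ : X ∈ Finset.univ) => h1 X
    have h3 : ∑ X, (f X * zigzagOp f X - f X * (S / N)) = 0 := by
      rw [Finset.sum_sub_distrib, ← hS, ← Finset.sum_mul, hf1]
      field_simp; ring
    have h4 : ∑ X, f X * zigzagOp f X * (Real.log (zigzagOp f X) - Real.log (S / N))
        = b - S * Real.log (S / N) := by
      rw [hb, hS, Finset.sum_mul, ← Finset.sum_sub_distrib]
      exact Finset.sum_congr rfl fun X _ => by ring
    rw [h3, h4] at h2
    linarith
  have hd' : (1 : ℝ) ≤ d := by exact_mod_cast hd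
  set ρ : ℝ := 1 / (864 * (d : ℝ) ^ 2) with hρ
  have hρ0 : 0 ≤ ρ := by positivity
  have hρ1 : ρ ≤ 1 := by
    rw [hρ, div_le_one (by positivity)]
    nlinarith
  have hρD : ρ * D' ≤ a - b := by
    rw [hρ, one_div, inv_mul_le_iff₀ (by positivity), ← hdis]
    exact hent
  have hB : Real.log (S / N) ≤ (1 - ρ) * Real.log Q := by
    have h1 := mul_le_mul_of_nonneg_left hg1 (sub_nonneg.2 hρ1)
    have h2 := mul_le_mul_of_nonneg_left hg2 (by positivity : 0 ≤ 2 * ρ)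
    have h3 : S * Real.log (S / N) ≤ S * ((1 - ρ) * Real.log Q) := by nlinarith
    exact le_of_mul_le_mul_left h3 hS0
  refine le_trans (Real.log_le_log ?_ ?_) hB
  · exact div_pos (Finset.sum_pos (fun X _ => pow_pos (hZ X) 2) Finset.univ_nonempty) hN0
  · have h1 := sum_sq_opList_palindrome_le (List.finRange d) f
    rw [← zigzagOp_eq] at h1
    exact div_le_div_of_nonneg_right h1 hN0.le

end Contraction

/-! ### Uniform mixing of the full deck -/

section Mixing

open scoped BigOperators

variable {d : ℕ}

theorem zigzagOp_iterate_pos (n : ℕ) {f : Equiv.Perm (Cube d) → ℝ} (hf : ∀ X, 0 < f X)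
    (X : Equiv.Perm (Cube d)) : 0 < zigzagOp^[n] f X := by
  induction n generalizing X with
  | zero => exact hf X
  | succ n ih =>
    rw [Function.iterate_succ_apply']
    exact opList_pos _ ih X

theorem sum_zigzagOp_iterate (n : ℕ) (f : Equiv.Perm (Cube d) → ℝ) :
    ∑ X, zigzagOp^[n] f X = ∑ X, f X := by
  induction n with
  | zero => rfl
  | succ n ih =>
    rw [Function.iterate_succ_apply', ← ih]
    exact sum_opList _ _

theorem sum_zigzagOp_iterate_mul (n : ℕ) (f f' : Equiv.Perm (Cube d) → ℝ) :
    ∑ X, zigzagOp^[n] f X * f' X = ∑ X, f X * zigzagOp^[n] f' X := by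
  induction n generalizing f' with
  | zero => rfl
  | succ n ih =>
    rw [Function.iterate_succ_apply', sum_zigzagOp_mul, ih, Function.iterate_succ_apply]

theorem zigzagOp_iterate_affine (n : ℕ) (a b : ℝ) (f : Equiv.Perm (Cube d) → ℝ) :
    zigzagOp^[n] (fun X => a * f X + b) = fun X => a * zigzagOp^[n] f X + b := by
  induction n with
  | zero => rfl
  | succ n ih =>
    rw [Function.iterate_succ_apply', ih, Function.iterate_succ_apply']
    unfold zigzagOp
    rw [opList_add, opList_const, opList_const_mul]

theorem log_sum_sq_iterate_le (hd : 1 ≤ d) {f : Equiv.Perm (Cube d) → ℝ} (hf : ∀ X, 0 < f X)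
    (hf1 : ∑ X, f X = Fintype.card (Equiv.Perm (Cube d))) (n : ℕ) :
    Real.log ((∑ X, zigzagOp^[n] f X ^ 2) / Fintype.card (Equiv.Perm (Cube d)))
      ≤ (1 - 1 / (864 * (d : ℝ) ^ 2)) ^ n *
        Real.log ((∑ X, f X ^ 2) / Fintype.card (Equiv.Perm (Cube d))) := by
  induction n with
  | zero => simp
  | succ n ih =>
    rw [Function.iterate_succ_apply']
    refine (log_sum_sq_zigzagOp_le hd (zigzagOp_iterate_pos n hf)
      (by rw [sum_zigzagOp_iterate, hf1])).trans ?_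
    have hd' : (1 : ℝ) ≤ d := by exact_mod_cast hd
    have hρ1 : 1 / (864 * (d : ℝ) ^ 2) ≤ 1 := by
      rw [div_le_one (by positivity)]
      nlinarith
    rw [pow_succ' (1 - 1 / (864 * (d : ℝ) ^ 2)) n, mul_assoc]
    exact mul_le_mul_of_nonneg_left ih (by linarith)

theorem log_card_perm_cube_le :
    Real.log (Fintype.card (Equiv.Perm (Cube d))) ≤ 2 ^ d * d := by
  have h1 : Fintype.card (Equiv.Perm (Cube d)) ≤ (2 ^ d) ^ (2 ^ d) := by
    rw [Fintype.card_perm]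
    have : Fintype.card (Cube d) = 2 ^ d := by simp
    rw [this]
    exact Nat.factorial_le_pow _
  have h2 : Real.log (Fintype.card (Equiv.Perm (Cube d))) ≤ Real.log (((2 : ℝ) ^ d) ^ (2 ^ d)) :=
    Real.log_le_log (by exact_mod_cast Fintype.card_pos) (by exact_mod_cast h1)
  rw [Real.log_pow, Real.log_pow] at h2
  have h3 : Real.log 2 ≤ 1 := by linarith [Real.log_two_lt_d9]
  refine h2.trans ?_
  push_cast
  refine mul_le_mul_of_nonneg_left ?_ (by positivity)
  have : (0 : ℝ) ≤ d := by positivity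
  nlinarith

theorem contraction_pow_mul_le (hd : 1 ≤ d) :
    (1 - 1 / (864 * (d : ℝ) ^ 2)) ^ (6912 * d ^ 4) * (2 ^ d * d) ≤ 1 / 32 := by
  have hd' : (1 : ℝ) ≤ d := by exact_mod_cast hd
  have hρ1 : 1 / (864 * (d : ℝ) ^ 2) ≤ 1 := by
    rw [div_le_one (by positivity)]
    nlinarith
  have h1 : (1 - 1 / (864 * (d : ℝ) ^ 2)) ^ (6912 * d ^ 4) ≤ Real.exp (-(8 * (d : ℝ) ^ 2)) := by
    have h2 : 1 - 1 / (864 * (d : ℝ) ^ 2) ≤ Real.exp (-(1 / (864 * (d : ℝ) ^ 2))) :=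
      Real.one_sub_le_exp_neg _
    refine (pow_le_pow_left₀ (by linarith) h2 _).trans (le_of_eq ?_)
    rw [← Real.exp_nat_mul]
    congr 1
    push_cast
    field_simp
    norm_num
  have h2 : (2 : ℝ) ^ d ≤ Real.exp d := by
    have : (2 : ℝ) ≤ Real.exp 1 := by linarith [Real.add_one_le_exp (1 : ℝ)]
    calc (2 : ℝ) ^ d ≤ Real.exp 1 ^ d := pow_le_pow_left₀ (by norm_num) this d
      _ = Real.exp d := by rw [← Real.exp_nat_mul, mul_one]
  have h3 : (d : ℝ) ≤ Real.exp d := by linarith [Real.add_one_le_exp (d : ℝ)]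
  have h4 : Real.exp (-(8 * (d : ℝ) ^ 2)) * (Real.exp d * Real.exp d) ≤ 1 / 32 := by
    rw [← Real.exp_add, ← Real.exp_add]
    have h5 : -(8 * (d : ℝ) ^ 2) + (d + d) ≤ -5 := by nlinarith
    have h6 : (32 : ℝ) ≤ Real.exp 5 := by
      have : (2 : ℝ) ≤ Real.exp 1 := by linarith [Real.add_one_le_exp (1 : ℝ)]
      calc (32 : ℝ) = 2 ^ 5 := by norm_num
        _ ≤ Real.exp 1 ^ 5 := pow_le_pow_left₀ (by norm_num) this 5
        _ = Real.exp 5 := by rw [← Real.exp_nat_mul]; norm_num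
    refine (Real.exp_le_exp.2 h5).trans ?_
    rw [Real.exp_neg, one_div]
    exact inv_anti₀ (by norm_num) h6
  refine le_trans ?_ h4
  exact mul_le_mul h1 (mul_le_mul h2 h3 (by positivity) (by positivity)) (by positivity)
    (by positivity)

theorem sum_sq_sub_one_le (hd : 1 ≤ d) (Y : Equiv.Perm (Cube d)) :
    ∑ X, (zigzagOp^[6912 * d ^ 4]
        (fun W => if W = Y then (Fintype.card (Equiv.Perm (Cube d)) : ℝ) else 0) X - 1) ^ 2
      ≤ (Fintype.card (Equiv.Perm (Cube d)) : ℝ) / 4 := by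
  set N : ℝ := (Fintype.card (Equiv.Perm (Cube d)) : ℝ) with hN
  set n := 6912 * d ^ 4
  have hN1 : 1 ≤ N := by rw [hN]; exact_mod_cast Fintype.card_pos
  have hN0 : 0 < N := by linarith
  set δ : Equiv.Perm (Cube d) → ℝ := fun W => if W = Y then N else 0 with hδ
  set f : Equiv.Perm (Cube d) → ℝ := fun W => 1 / 2 * δ W + 1 / 2 with hf
  have hδsum : ∑ X, δ X = N := by simp [hδ]
  have hfpos : ∀ X, 0 < f X := fun X => by
    simp only [hf, hδ]; split_ifs <;> linarith
  have hfle : ∀ X, f X ≤ N := fun X => by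
    simp only [hf, hδ]; split_ifs <;> linarith
  have hf1 : ∑ X, f X = N := by
    simp only [hf]
    rw [Finset.sum_add_distrib, ← Finset.mul_sum, hδsum, Finset.sum_const, Finset.card_univ,
      nsmul_eq_mul, ← hN]
    ring
  have hf2 : (∑ X, f X ^ 2) / N ≤ N := by
    rw [div_le_iff₀ hN0]
    calc ∑ X, f X ^ 2 ≤ ∑ X, N * f X := Finset.sum_le_sum fun X _ => by
          rw [sq]; exact mul_le_mul_of_nonneg_right (hfle X) (hfpos X).le
      _ = N * N := by rw [← Finset.mul_sum, hf1]
  have hd' : (1 : ℝ) ≤ d := by exact_mod_cast hd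
  have hρ1 : 1 / (864 * (d : ℝ) ^ 2) ≤ 1 := by
    rw [div_le_one (by positivity)]
    nlinarith
  have hR0 : Real.log ((∑ X, f X ^ 2) / N) ≤ 2 ^ d * d :=
    (Real.log_le_log (div_pos (Finset.sum_pos (fun X _ => pow_pos (hfpos X) 2)
      Finset.univ_nonempty) hN0) hf2).trans log_card_perm_cube_le
  have hR : Real.log ((∑ X, zigzagOp^[n] f X ^ 2) / N) ≤ 1 / 32 :=
    (log_sum_sq_iterate_le hd hfpos hf1 n).trans
      ((mul_le_mul_of_nonneg_left hR0 (pow_nonneg (by linarith) _)).trans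
        (contraction_pow_mul_le hd))
  have hQ : (∑ X, zigzagOp^[n] f X ^ 2) / N ≤ 17 / 16 := by
    have hpos : 0 < (∑ X, zigzagOp^[n] f X ^ 2) / N :=
      div_pos (Finset.sum_pos (fun X _ => pow_pos (zigzagOp_iterate_pos n hfpos X) 2)
        Finset.univ_nonempty) hN0
    have h1 := Real.exp_le_exp.2 hR
    rw [Real.exp_log hpos] at h1
    have h2 : Real.exp (1 / 32) ≤ 17 / 16 := by
      have h3 := Real.one_sub_le_exp_neg (1 / 32 : ℝ)
      rw [Real.exp_neg] at h3
      have h4 : Real.exp (1 / 32 : ℝ) * (1 - 1 / 32) ≤ 1 := by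
        calc _ ≤ Real.exp (1 / 32 : ℝ) * (Real.exp (1 / 32 : ℝ))⁻¹ :=
              mul_le_mul_of_nonneg_left h3 (Real.exp_pos _).le
          _ = 1 := mul_inv_cancel₀ (Real.exp_pos _).ne'
      linarith
    exact h1.trans h2
  rw [div_le_iff₀ hN0] at hQ
  have haff : ∀ X, zigzagOp^[n] f X = 1 / 2 * zigzagOp^[n] δ X + 1 / 2 := fun X =>
    congrFun (zigzagOp_iterate_affine n (1 / 2) (1 / 2) δ) X
  have h1 : ∑ X, (zigzagOp^[n] δ X - 1) ^ 2
      = 4 * ∑ X, zigzagOp^[n] f X ^ 2 - 8 * ∑ X, zigzagOp^[n] f X + ∑ _X : Equiv.Perm (Cube d), 4 := by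
    rw [Finset.mul_sum, Finset.mul_sum, ← Finset.sum_sub_distrib, ← Finset.sum_add_distrib]
    refine Finset.sum_congr rfl fun X _ => ?_
    rw [haff]; ring
  rw [h1, sum_zigzagOp_iterate, hf1, Finset.sum_const, Finset.card_univ, nsmul_eq_mul, ← hN]
  linarith

theorem abs_zigzagOp_iterate_sub_one_le (hd : 1 ≤ d) (X Y : Equiv.Perm (Cube d)) :
    |zigzagOp^[2 * (6912 * d ^ 4)]
        (fun W => if W = Y then (Fintype.card (Equiv.Perm (Cube d)) : ℝ) else 0) X - 1|
      ≤ 1 / 4 := by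
  have hX := sum_sq_sub_one_le hd X
  have hY := sum_sq_sub_one_le hd Y
  set N : ℝ := (Fintype.card (Equiv.Perm (Cube d)) : ℝ) with hN
  set n := 6912 * d ^ 4
  have hN0 : 0 < N := by rw [hN]; exact_mod_cast Fintype.card_pos
  set u := zigzagOp^[n] (fun W => if W = Y then N else 0) with hu
  set v := zigzagOp^[n] (fun W => if W = X then N else 0) with hv
  have hus : ∑ W, u W = N := by rw [hu, sum_zigzagOp_iterate]; simp
  have hvs : ∑ W, v W = N := by rw [hv, sum_zigzagOp_iterate]; simp
  have h1 : N * zigzagOp^[2 * n] (fun W => if W = Y then N else 0) X = ∑ W, u W * v W := by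
    rw [two_mul, Function.iterate_add_apply, ← hu, hv, ← sum_zigzagOp_iterate_mul]
    simp [mul_comm]
  have h2 : ∑ W, (u W - 1) * (v W - 1) = ∑ W, u W * v W - N := by
    have h3 : ∀ W, (u W - 1) * (v W - 1) = u W * v W - u W - v W + 1 := fun W => by ring
    rw [Finset.sum_congr rfl fun W _ => h3 W, Finset.sum_add_distrib, Finset.sum_sub_distrib,
      Finset.sum_sub_distrib, hus, hvs, Finset.sum_const, Finset.card_univ, nsmul_eq_mul, ← hN]
    ring
  have h3 : |∑ W, (u W - 1) * (v W - 1)| ≤ N / 4 := by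
    refine (Finset.abs_sum_le_sum_abs _ _).trans ?_
    have h4 : ∀ W, |(u W - 1) * (v W - 1)| ≤ ((u W - 1) ^ 2 + (v W - 1) ^ 2) / 2 := fun W => by
      rw [abs_le]
      constructor
      · nlinarith [sq_nonneg (u W - 1 + (v W - 1))]
      · nlinarith [sq_nonneg (u W - 1 - (v W - 1))]
    refine (Finset.sum_le_sum fun W _ => h4 W).trans ?_
    rw [← Finset.sum_div, Finset.sum_add_distrib]
    linarith
  rw [h2, ← h1] at h3
  have h5 : N * zigzagOp^[2 * n] (fun W => if W = Y then N else 0) X - N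
      = N * (zigzagOp^[2 * n] (fun W => if W = Y then N else 0) X - 1) := by ring
  rw [h5, abs_mul, abs_of_pos hN0] at h3
  have h6 : N * |zigzagOp^[2 * n] (fun W => if W = Y then N else 0) X - 1| ≤ N * (1 / 4) := by
    linarith
  exact le_of_mul_le_mul_left h6 hN0

end Mixing

/-! ### From the law of the shuffle to the averaging operators -/

section Law

open scoped BigOperators

/-- The probability that at time `m` the shuffle has moved the initial arrangement `X₀` by the
permutation `σ` of the positions. -/
noncomputable def permLaw (d : ℕ) [NeZero d] (X₀ : Deck d) (m : ℕ) (σ : Equiv.Perm (Cube d)) : ℝ :=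
  (zigzagLaw d X₀ m (X₀.trans σ)).toReal

theorem zigzagLaw_succ_apply (d : ℕ) [NeZero d] (X₀ : Deck d) (m : ℕ) (Y : Deck d) :
    zigzagLaw d X₀ (m + 1) Y = ∑ c : DirEdge (zigzagDir d m) → Bool,
      (Fintype.card (DirEdge (zigzagDir d m) → Bool) : ENNReal)⁻¹ *
        zigzagLaw d X₀ m (Y.trans (switchEdges (zigzagDir d m) c)) := by
  set j := zigzagDir d m with hj
  have h1 : zigzagLaw d X₀ (m + 1) = (PMF.uniformOfFintype (DirEdge j → Bool)).bind fun c =>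
      (zigzagLaw d X₀ m).bind fun X => PMF.pure (X.trans (switchEdges j c)) :=
    PMF.bind_comm _ _ _
  rw [h1, PMF.bind_apply, tsum_fintype]
  refine Finset.sum_congr rfl fun c _ => ?_
  rw [PMF.uniformOfFintype_apply, PMF.bind_apply, tsum_eq_single (Y.trans (switchEdges j c))]
  · have h2 : (Y.trans (switchEdges j c)).trans (switchEdges j c) = Y := by
      ext z : 1
      exact (switchEdges j c).injective (by
        rw [Equiv.trans_apply, Equiv.trans_apply, ← Equiv.Perm.mul_apply]
        nth_rewrite 2 [← switchEdges_inv]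
        simp)
    rw [h2, PMF.pure_apply, if_pos rfl, mul_one]
  · intro X hX
    rw [PMF.pure_apply, if_neg, mul_zero]
    rintro rfl
    refine hX ?_
    ext z : 1
    simp only [Equiv.trans_apply]
    nth_rewrite 1 [← switchEdges_inv]
    simp

theorem permLaw_zero (d : ℕ) [NeZero d] (X₀ : Deck d) :
    permLaw d X₀ 0 = fun σ => if σ = 1 then 1 else 0 := by
  funext σ
  have h : X₀.trans σ = X₀ ↔ σ = 1 := by
    constructor
    · intro h
      ext x : 1
      simpa using congrArg (fun e : Deck d => e (X₀.symm x)) h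
    · rintro rfl
      rfl
  simp only [permLaw, zigzagLaw, PMF.pure_apply, h]
  split_ifs <;> simp

theorem permLaw_succ (d : ℕ) [NeZero d] (X₀ : Deck d) (m : ℕ) :
    permLaw d X₀ (m + 1) = avgSub (switchSub (zigzagDir d m)) (permLaw d X₀ m) := by
  funext σ
  rw [← expect_switchEdges, expect_eq_sum_inv_card_mul]
  unfold permLaw
  rw [zigzagLaw_succ_apply, ENNReal.toReal_sum fun c _ =>
    ENNReal.mul_ne_top (by simp) (PMF.apply_ne_top _ _)]
  refine Finset.sum_congr rfl fun c _ => ?_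
  rw [ENNReal.toReal_mul, ENNReal.toReal_inv, ENNReal.toReal_natCast]
  rfl

theorem getElem_zigzagDir (d : ℕ) [NeZero d] (q k : ℕ) (hk : k < 2 * d) :
    (List.finRange d ++ (List.finRange d).reverse)[k]'(by simp; omega)
      = zigzagDir d (2 * d * q + k) := by
  have hmod : (2 * d * q + k) % (2 * d) = k := by
    rw [Nat.mul_add_mod, Nat.mod_eq_of_lt hk]
  by_cases h : k < d
  · rw [List.getElem_append_left (by simpa using h)]
    ext
    simp [zigzagDir, hmod, h]
  · rw [List.getElem_append_right (by simpa using h)]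
    ext
    simp [zigzagDir, hmod, h]
    omega

theorem permLaw_mul_add (d : ℕ) [NeZero d] (X₀ : Deck d) (q k : ℕ) (hk : k ≤ 2 * d) :
    permLaw d X₀ (2 * d * q + k)
      = opList ((List.finRange d ++ (List.finRange d).reverse).take k).reverse
          (permLaw d X₀ (2 * d * q)) := by
  induction k with
  | zero => rfl
  | succ k ih =>
    rw [← add_assoc, permLaw_succ, ih (by omega), ← getElem_zigzagDir d q k (by omega),
      ← List.take_concat_get' _ _ (by simp; omega), List.reverse_append,
      List.reverse_singleton, List.singleton_append, opList_cons]

theorem permLaw_two_mul (d : ℕ) [NeZero d] (X₀ : Deck d) (n : ℕ) :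
    permLaw d X₀ (2 * d * n) = zigzagOp^[n] fun σ => if σ = 1 then 1 else 0 := by
  induction n with
  | zero => exact permLaw_zero d X₀
  | succ n ih =>
    rw [mul_add, mul_one, permLaw_mul_add d X₀ n (2 * d) le_rfl, ih,
      List.take_of_length_le (by simp; omega), List.reverse_append, List.reverse_reverse,
      Function.iterate_succ_apply']
    rfl

theorem moveProb_eq_sum (d : ℕ) [NeZero d] (X₀ : Deck d) (m : ℕ) (Λ : Finset (Fin (2 ^ d)))
    (Λ' : Finset (Cube d)) :
    moveProb d X₀ m Λ Λ' = ∑ σ : Equiv.Perm (Cube d) with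
      (positions Λ X₀).map σ.toEmbedding = Λ', permLaw d X₀ m σ := by
  classical
  have h1 : ∀ X : Deck d, (if Λ' = positions Λ X then zigzagLaw d X₀ m X else 0) ≠ ⊤ := fun X => by
    split_ifs
    · exact PMF.apply_ne_top _ _
    · simp
  have h2 : moveProb d X₀ m Λ Λ' = ∑ X : Deck d,
      (if Λ' = positions Λ X then zigzagLaw d X₀ m X else 0).toReal := by
    unfold moveProb
    rw [PMF.map_apply, tsum_fintype, ← ENNReal.toReal_sum fun X _ => h1 X]
    congr!
  rw [h2, Finset.sum_filter]
  refine (Fintype.sum_equiv (Equiv.equivCongr X₀.symm (Equiv.refl (Cube d))) _ _ fun σ => ?_).symm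
  have h3 : Equiv.equivCongr X₀.symm (Equiv.refl (Cube d)) σ = X₀.trans σ := by
    ext; simp
  have h4 : positions Λ (X₀.trans σ) = (positions Λ X₀).map σ.toEmbedding := by
    simp [positions, Finset.map_map]
  rw [h3, h4]
  simp only [eq_comm (a := Λ')]
  split_ifs <;> rfl

theorem exists_perm_map_eq {α : Type*} [Fintype α] {A B : Finset α} (h : A.card = B.card) :
    ∃ τ : Equiv.Perm α, A.map τ.toEmbedding = B := by
  classical
  refine ⟨(Finset.equivOfCardEq h).extendSubtype, ?_⟩
  refine Finset.eq_of_subset_of_card_le (fun x hx => ?_) (by simp [h])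
  obtain ⟨a, ha, rfl⟩ := Finset.mem_map.1 hx
  exact Equiv.extendSubtype_mem _ a ha

theorem card_perm_map_eq_mul_choose {α : Type*} [Fintype α] [DecidableEq α] {A B : Finset α}
    (h : A.card = B.card) :
    ({σ : Equiv.Perm α | A.map σ.toEmbedding = B} : Finset (Equiv.Perm α)).card
      * (Fintype.card α).choose A.card = Fintype.card (Equiv.Perm α) := by
  have h1 : Fintype.card (Equiv.Perm α)
      = ∑ C ∈ Finset.powersetCard A.card (Finset.univ : Finset α),
        ({σ : Equiv.Perm α | A.map σ.toEmbedding = C} : Finset (Equiv.Perm α)).card := by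
    rw [← Finset.card_univ]
    exact Finset.card_eq_sum_card_fiberwise fun σ _ => by simp [Finset.mem_powersetCard]
  have h2 : ∀ C ∈ Finset.powersetCard A.card (Finset.univ : Finset α),
      ({σ : Equiv.Perm α | A.map σ.toEmbedding = C} : Finset (Equiv.Perm α)).card
        = ({σ : Equiv.Perm α | A.map σ.toEmbedding = B} : Finset (Equiv.Perm α)).card := by
    intro C hC
    have hC' : C.card = B.card := (Finset.mem_powersetCard.1 hC).2.trans h
    obtain ⟨τ, hτ⟩ := exists_perm_map_eq hC'
    refine Finset.card_equiv (Equiv.mulLeft τ) fun σ => ?_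
    have h3 : A.map (τ * σ).toEmbedding = (A.map σ.toEmbedding).map τ.toEmbedding := by
      rw [Finset.map_map]; rfl
    simp only [Finset.mem_filter, Finset.mem_univ, true_and, Equiv.coe_mulLeft]
    rw [h3, ← hτ, (Finset.map_injective _).eq_iff]
  rw [h1, Finset.sum_congr rfl h2, Finset.sum_const, Finset.card_powersetCard, Finset.card_univ,
    smul_eq_mul, mul_comm]

theorem abs_card_mul_permLaw_sub_one_le (d : ℕ) [NeZero d] (X₀ : Deck d)
    (σ : Equiv.Perm (Cube d)) :
    |(Fintype.card (Equiv.Perm (Cube d)) : ℝ) * permLaw d X₀ (27648 * d ^ 5) σ - 1| ≤ 1 / 4 := by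
  have hd : 1 ≤ d := Nat.one_le_iff_ne_zero.2 (NeZero.ne d)
  have h := abs_zigzagOp_iterate_sub_one_le hd σ 1
  set N : ℝ := (Fintype.card (Equiv.Perm (Cube d)) : ℝ)
  have h1 : (fun W : Equiv.Perm (Cube d) => if W = 1 then N else 0)
      = fun W => N * (if W = 1 then 1 else 0) + 0 := by
    funext W; simp
  rw [h1, zigzagOp_iterate_affine, ← permLaw_two_mul d X₀] at h
  simp only [add_zero] at h
  rwa [show 27648 * d ^ 5 = 2 * d * (2 * (6912 * d ^ 4)) by ring]

end Law

theorem mainTheorem4 :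
    ∃ b : ℕ, ∀ (d : ℕ) [NeZero d] (X₀ : Deck d)
      (Λ : Finset (Fin (2 ^ d))) (Λ' : Finset (Cube d)), Λ'.card = Λ.card →
        |((2 ^ d).choose Λ.card : ℝ) * moveProb d X₀ (b * d ^ 5) Λ Λ' - 1| ≤ 1 / 4 := by
  refine ⟨27648, fun d _ X₀ Λ Λ' hΛ => ?_⟩
  have hcard : (positions Λ X₀).card = Λ.card := by simp [positions]
  have hS := card_perm_map_eq_mul_choose (hcard.trans hΛ.symm)
  rw [hcard, show Fintype.card (Cube d) = 2 ^ d by simp] at hS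
  rw [moveProb_eq_sum]
  set S : Finset (Equiv.Perm (Cube d)) :=
    {σ : Equiv.Perm (Cube d) | (positions Λ X₀).map σ.toEmbedding = Λ'}
  set N : ℝ := (Fintype.card (Equiv.Perm (Cube d)) : ℝ) with hN
  have hN0 : 0 < N := by rw [hN]; exact_mod_cast Fintype.card_pos
  set C : ℝ := ((2 ^ d).choose Λ.card : ℝ) with hC
  have hC0 : 0 ≤ C := Nat.cast_nonneg _
  have hS' : (S.card : ℝ) * C = N := by rw [hC, hN]; exact_mod_cast hS
  set p := permLaw d X₀ (27648 * d ^ 5)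
  have h1 : C * ∑ σ ∈ S, p σ - 1 = C / N * ∑ σ ∈ S, (N * p σ - 1) := by
    rw [Finset.sum_sub_distrib, ← Finset.mul_sum, Finset.sum_const, nsmul_eq_mul, mul_one]
    field_simp
    linarith
  have h2 : |∑ σ ∈ S, (N * p σ - 1)| ≤ S.card * (1 / 4) := by
    refine (Finset.abs_sum_le_sum_abs _ _).trans ?_
    rw [← nsmul_eq_mul]
    exact Finset.sum_le_card_nsmul _ _ _ fun σ _ => abs_card_mul_permLaw_sub_one_le d X₀ σ
  rw [h1, abs_mul, abs_of_nonneg (div_nonneg hC0 hN0.le)]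
  refine (mul_le_mul_of_nonneg_left h2 (div_nonneg hC0 hN0.le)).trans (le_of_eq ?_)
  rw [show C / N * (S.card * (1 / 4)) = S.card * C / N * (1 / 4) by ring, hS',
    div_self hN0.ne', one_mul]
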